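/- Let $n\ge 2$ be an integer. For $\alpha\in\mathbb{R}$ put $$\delta_{n,\alpha}:=\inf_{u\in C^2_c(\mathbb{R}^n\setminus\{0\}),\ u\neq 0}\frac{\int_{\mathbb{R}^n}|x|^{\alpha}|\Delta u|^2\,dx}{\int_{\mathbb{R}^n}|x|^{\alpha-2}|\nabla u|^2\,dx},$$ the infimum being over real-valued functions, and let $\delta^{\rm rad}_{n,\alpha}$ be the infimum of the same quotient over the radially symmetric functions $u\in C^2_c(\mathbb{R}^n\setminus\{0\})$, $u\ne 0$. Then in the critical case $\alpha=4-n$ $$\delta_{n,4-n}=\min\left\{(n-2)^2,\ n-1\right\}.$$ In particular, $\delta_{n,4-n}>0$ if $n\ge 3$, and $\delta_{n,4-n}=n-1<\delta^{\rm rad}_{n,4-n}$ if $n\ge 4$. -/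

import Mathlib

open MeasureTheory

noncomputable section

namespace WeightedRellich

/-- The real-valued functions of class `C²` on `ℝⁿ` that do not vanish identically and whose
(closed) support is a compact subset of `ℝⁿ ∖ {0}`. -/
def TestFunctions (n : ℕ) : Set (EuclideanSpace ℝ (Fin n) → ℝ) :=
  {u | ContDiff ℝ 2 u ∧ HasCompactSupport u ∧ (0 : EuclideanSpace ℝ (Fin n)) ∉ tsupport u ∧ u ≠ 0}

/-- `u` is radially symmetric: `u x` depends only on `‖x‖`. -/
def IsRadial {n : ℕ} (u : EuclideanSpace ℝ (Fin n) → ℝ) : Prop :=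
  ∀ x y, ‖x‖ = ‖y‖ → u x = u y

/-- The numerator `∫ |x|^α |Δu|² dx`. -/
def laplacianEnergy {n : ℕ} (α : ℝ) (u : EuclideanSpace ℝ (Fin n) → ℝ) : ℝ :=
  ∫ x, ‖x‖ ^ α * Laplacian.laplacian u x ^ 2

/-- The denominator `∫ |x|^(α-2) |∇u|² dx`. -/
def gradientEnergy {n : ℕ} (α : ℝ) (u : EuclideanSpace ℝ (Fin n) → ℝ) : ℝ :=
  ∫ x, ‖x‖ ^ (α - 2) * ‖gradient u x‖ ^ 2

/-- The quotient that is minimized. -/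
def quotient {n : ℕ} (α : ℝ) (u : EuclideanSpace ℝ (Fin n) → ℝ) : ℝ :=
  laplacianEnergy α u / gradientEnergy α u

/-- The best constant `δ_{n,α}`: the infimum of the quotient over all test functions. -/
def bestConstant (n : ℕ) (α : ℝ) : ℝ :=
  sInf (quotient α '' TestFunctions n)

/-- The radial constant `δ_{n,α}^rad`: the infimum over radially symmetric test functions. -/
def radialConstant (n : ℕ) (α : ℝ) : ℝ :=
  sInf (quotient α '' {u ∈ TestFunctions n | IsRadial u})

/-- Both infima are over sets that are bounded below. -/
theorem quotient_nonneg {n : ℕ} (α : ℝ) (u : EuclideanSpace ℝ (Fin n) → ℝ) :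
    0 ≤ quotient α u := by
  unfold quotient laplacianEnergy gradientEnergy
  refine div_nonneg (integral_nonneg fun x => ?_) (integral_nonneg fun x => ?_)
  · exact mul_nonneg (Real.rpow_nonneg (norm_nonneg x) _) (sq_nonneg _)
  · exact mul_nonneg (Real.rpow_nonneg (norm_nonneg x) _) (sq_nonneg _)

/-- Both infima are over nonempty sets when `n ≥ 1`. -/
theorem exists_radial_testFunction {n : ℕ} (hn : 1 ≤ n) :
    {u ∈ TestFunctions n | IsRadial u}.Nonempty := by
  let f : ContDiffBump (1 : ℝ) := ⟨1 / 4, 1 / 2, by norm_num, by norm_num⟩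
  have hf0 : ∀ t : ℝ, 1 / 2 ≤ |t - 1| → f t = 0 := fun t ht =>
    f.zero_of_le_dist (by rw [Real.dist_eq]; exact ht)
  refine ⟨fun x => f (‖x‖ ^ 2), ⟨?_, ?_, ?_, ?_⟩, ?_⟩
  · exact f.contDiff.comp (contDiff_norm_sq ℝ)
  · refine HasCompactSupport.intro
      (isCompact_closedBall (0 : EuclideanSpace ℝ (Fin n)) 2) fun x hx => hf0 _ ?_
    have hx' : 2 < ‖x‖ := by simpa using hx
    exact le_trans (by nlinarith) (le_abs_self _)
  · rw [notMem_tsupport_iff_eventuallyEq]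
    filter_upwards [Metric.ball_mem_nhds (0 : EuclideanSpace ℝ (Fin n))
      (by norm_num : (0 : ℝ) < 1 / 2)] with x hx
    have hx' : ‖x‖ < 1 / 2 := by simpa using hx
    exact hf0 _ (le_trans (by nlinarith [norm_nonneg x]) (neg_le_abs _))
  · intro h
    have h1 := congrFun h (EuclideanSpace.single (⟨0, hn⟩ : Fin n) (1 : ℝ))
    have h2 : f 1 = 1 := f.one_of_mem_closedBall (by simp [f])
    simp [h2] at h1
  · intro x y hxy
    simp only [hxy]

end WeightedRellich

end

open Filter Topology InnerProductSpace

set_option linter.unusedSectionVars false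

/-! Let g = ∇u and H = Dg, which is symmetric. For n ≥ 3 the lower bound is
`weighted_field_inequality`: the radial part of |∇u|² in the weighted energy costs (n-2)², the
tangential part costs n-1, and each constant is at least the minimum. Radial functions have no
tangential part, which gives the bound (n-2)² for them. For n = 2 the minimum is 0 and nonnegativity
suffices.

No spherical harmonics are used. The difference of the two densities is a combination of five terms
with zero integral plus |x|^(-n) times a nonnegative remainder (`density_inequality`). Three of
these terms are divergences of weighted fields; two are null Lagrangians div F div G - tr(DF DG). As
u is only C², the latter must be integrated for C¹ fields, without second derivatives of F or G
(`integral_ctrace_mul_sub_ctrace_comp`). The remainder measures the gradient of ⟨x, g⟩ and the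
trace-free tangential part of H; it vanishes for log|x| and for ⟨e, x⟩/|x|.

These two functions point to the minimizing families φ(ε log|x|) and φ(ε log|x|)⟨e, x⟩/|x|. With t =
log|x| the measure |x|^(-n) dx becomes a multiple of dt, each derivative of the cutoff costs a
factor ε, and as ε → 0 the quotients tend to (n-2)² and (n-1)²/(n-1) = n-1. -/

namespace WeightedRellich

/-! ### Integration by parts for compactly supported C¹ fields -/

section IntegrationByParts

variable {V : Type*} [NormedAddCommGroup V] [InnerProductSpace ℝ V] [FiniteDimensional ℝ V]

/-- The trace of a continuous endomorphism of a finite-dimensional space. -/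
noncomputable def ctrace (A : V →L[ℝ] V) : ℝ := LinearMap.trace ℝ V (A : V →ₗ[ℝ] V)

theorem ctrace_eq_sum_inner {ι : Type*} [Fintype ι] (b : OrthonormalBasis ι ℝ V)
    (A : V →L[ℝ] V) : ctrace A = ∑ i, ⟪b i, A (b i)⟫_ℝ :=
  LinearMap.trace_eq_sum_inner _ b

theorem ctrace_comp_eq_sum_inner {ι : Type*} [Fintype ι] (b : OrthonormalBasis ι ℝ V)
    (A B : V →L[ℝ] V) :
    ctrace (A ∘L B) = ∑ i, ∑ j, ⟪b i, A (b j)⟫_ℝ * ⟪b j, B (b i)⟫_ℝ := by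
  rw [ctrace_eq_sum_inner b]
  refine Finset.sum_congr rfl fun i _ => ?_
  conv_lhs => rw [ContinuousLinearMap.comp_apply, ← b.sum_repr' (B (b i))]
  simp only [map_sum, map_smul, inner_sum, inner_smul_right]
  exact Finset.sum_congr rfl fun j _ => mul_comm _ _

theorem ctrace_add (A B : V →L[ℝ] V) : ctrace (A + B) = ctrace A + ctrace B := by
  simp [ctrace]

theorem ctrace_smul (c : ℝ) (A : V →L[ℝ] V) : ctrace (c • A) = c * ctrace A := by
  simp [ctrace]

theorem ctrace_id : ctrace (ContinuousLinearMap.id ℝ V) = Module.finrank ℝ V := by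
  simp [ctrace]

theorem ctrace_smulRight (f : V →L[ℝ] ℝ) (v : V) : ctrace (f.smulRight v) = f v := by
  exact LinearMap.trace_smulRight (R := ℝ) (f : V →ₗ[ℝ] ℝ) v

theorem continuous_ctrace : Continuous (ctrace : (V →L[ℝ] V) → ℝ) := by
  have : (ctrace : (V →L[ℝ] V) → ℝ) =
      fun A => ∑ i, ⟪stdOrthonormalBasis ℝ V i, A (stdOrthonormalBasis ℝ V i)⟫_ℝ := by
    ext A; exact ctrace_eq_sum_inner _ A
  rw [this]
  fun_prop

theorem ctrace_zero : ctrace (0 : V →L[ℝ] V) = 0 := by simp [ctrace]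

variable [MeasurableSpace V] [BorelSpace V]

theorem integrable_fderiv_apply {f : V → ℝ} (hf : ContDiff ℝ 1 f)
    (hc : HasCompactSupport f) (v : V) : Integrable fun x => fderiv ℝ f x v :=
  ((hf.continuous_fderiv one_ne_zero).clm_apply continuous_const).integrable_of_hasCompactSupport
    (hc.fderiv_apply ℝ v)

theorem integral_fderiv_apply_eq_zero {f : V → ℝ} (hf : ContDiff ℝ 1 f)
    (hc : HasCompactSupport f) (v : V) : ∫ x, fderiv ℝ f x v = 0 := by
  have h := integral_mul_fderiv_eq_neg_fderiv_mul_of_integrable (μ := (volume : Measure V))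
    (f := fun _ : V => (1 : ℝ)) (g := f) (v := v) (by simp)
    (by simpa using integrable_fderiv_apply hf hc v)
    (by simpa using hf.continuous.integrable_of_hasCompactSupport hc)
    (fun x _ => differentiableAt_const _)
    (fun x _ => (hf.differentiable one_ne_zero) x)
  simpa using h

/-- For functions of class `C¹` with compact support, the derivatives in `∫ ∂ᵥf ∂_w g` can be
interchanged, although the second derivatives need not exist. -/
theorem integral_fderiv_mul_fderiv_comm {f g : V → ℝ} (hf : ContDiff ℝ 1 f) (hg : ContDiff ℝ 1 g)
    (hfc : HasCompactSupport f) (hgc : HasCompactSupport g) (v w : V) :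
    ∫ x, fderiv ℝ f x v * fderiv ℝ g x w = ∫ x, fderiv ℝ f x w * fderiv ℝ g x v := by
  obtain ⟨C, hC⟩ := ContDiff.lipschitzWith_of_hasCompactSupport hfc hf one_ne_zero
  obtain ⟨D, hD⟩ := ContDiff.lipschitzWith_of_hasCompactSupport hgc hg one_ne_zero
  have hfd := hf.differentiable one_ne_zero
  have hgd := hg.differentiable one_ne_zero
  have hf' : Continuous fun x => fderiv ℝ f x w :=
    (hf.continuous_fderiv one_ne_zero).clm_apply continuous_const
  have hg' : Continuous fun x => fderiv ℝ g x w :=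
    (hg.continuous_fderiv one_ne_zero).clm_apply continuous_const
  have A := LipschitzWith.integral_inv_smul_sub_mul_tendsto_integral_lineDeriv_mul
    (μ := (volume : Measure V)) hC (integrable_fderiv_apply hg hgc w) v
  have B := LipschitzWith.integral_inv_smul_sub_mul_tendsto_integral_lineDeriv_mul
    (μ := (volume : Measure V)) hD (integrable_fderiv_apply hf hfc w) (-v)
  -- The difference quotient replaces ∂ᵥ, so only first derivatives occur: ∂_w is integrated by
  -- parts from g to f, and the difference in direction v is then shifted to g by translation
  -- invariance. Letting t → 0 gives the claim.
  have key : ∀ t : ℝ, ∫ x, (t⁻¹ • (f (x + t • v) - f x)) * fderiv ℝ g x w =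
      - ∫ x, (t⁻¹ • (g (x + t • (-v)) - g x)) * fderiv ℝ f x w := by
    intro t
    have hi1 : Integrable fun x => fderiv ℝ f (x + t • v) w * g x :=
      Continuous.integrable_of_hasCompactSupport
        ((hf'.comp (continuous_add_const _)).mul hg.continuous) hgc.mul_left
    have hi2 : Integrable fun x => fderiv ℝ f x w * g x :=
      Continuous.integrable_of_hasCompactSupport (hf'.mul hg.continuous) hgc.mul_left
    have hi3 : Integrable fun x => fderiv ℝ f x w * g (x + t • (-v)) :=
      Continuous.integrable_of_hasCompactSupport
        (hf'.mul (hg.continuous.comp (continuous_add_const _))) (hfc.fderiv_apply ℝ w).mul_right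
    have hder : ∀ x, fderiv ℝ (fun y => f (y + t • v) - f y) x w =
        fderiv ℝ f (x + t • v) w - fderiv ℝ f x w := by
      intro x
      have h1 : DifferentiableAt ℝ (fun y => f (y + t • v)) x :=
        (hfd _).comp x (differentiableAt_id.add_const _)
      rw [fderiv_fun_sub h1 (hfd x), fderiv_comp_add_right]
      rfl
    have hdiff : Continuous fun y => f (y + t • v) - f y :=
      (hf.continuous.comp (continuous_add_const _)).sub hf.continuous
    have h := integral_mul_fderiv_eq_neg_fderiv_mul_of_integrable (μ := (volume : Measure V))
      (f := fun y => f (y + t • v) - f y) (g := g) (v := w)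
      (by simp only [hder, sub_mul]; exact hi1.sub hi2)
      ((hdiff.mul hg').integrable_of_hasCompactSupport (hgc.fderiv_apply ℝ w).mul_left)
      ((hdiff.mul hg.continuous).integrable_of_hasCompactSupport hgc.mul_left)
      (fun x _ => ((hfd _).comp x (differentiableAt_id.add_const _)).sub (hfd x))
      (fun x _ => hgd x)
    have hshift : ∫ x, fderiv ℝ f (x + t • v) w * g x =
        ∫ x, fderiv ℝ f x w * g (x + t • (-v)) := by
      rw [← integral_add_right_eq_self _ (t • (-v))]; simp
    simp only [smul_eq_mul, mul_assoc, integral_const_mul]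
    rw [h]
    simp only [hder, sub_mul]
    rw [integral_sub hi1 hi2, hshift, ← integral_sub hi3 hi2, ← mul_neg]
    congr 2
    refine integral_congr_ae (Eventually.of_forall fun x => ?_)
    ring
  simp only [key] at A
  have hAB := tendsto_nhds_unique A B.neg
  simp only [fun x => (hfd x).lineDeriv_eq_fderiv (v := v),
    fun x => (hgd x).lineDeriv_eq_fderiv (v := -v), map_neg, neg_mul, integral_neg,
    neg_neg] at hAB
  rw [hAB]
  exact integral_congr_ae (Eventually.of_forall fun x => mul_comm _ _)

theorem integrable_ctrace_fderiv {F : V → V} (hF : ContDiff ℝ 1 F) (hc : HasCompactSupport F) :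
    Integrable fun x => ctrace (fderiv ℝ F x) :=
  (continuous_ctrace.comp (hF.continuous_fderiv one_ne_zero)).integrable_of_hasCompactSupport
    ((hc.fderiv ℝ).comp_left ctrace_zero)

theorem fderiv_inner_const_left {F : V → V} (hF : ContDiff ℝ 1 F) (e x v : V) :
    fderiv ℝ (fun y => ⟪e, F y⟫_ℝ) x v = ⟪e, fderiv ℝ F x v⟫_ℝ := by
  rw [fderiv_inner_apply ℝ (differentiableAt_const e) (hF.differentiable one_ne_zero x)]
  simp

theorem contDiff_inner_const_left {F : V → V} (hF : ContDiff ℝ 1 F) (e : V) :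
    ContDiff ℝ 1 fun y => ⟪e, F y⟫_ℝ := contDiff_const.inner ℝ hF

theorem hasCompactSupport_inner_const_left {F : V → V} (hc : HasCompactSupport F) (e : V) :
    HasCompactSupport fun y => ⟪e, F y⟫_ℝ :=
  hc.comp_left (g := fun z => ⟪e, z⟫_ℝ) (inner_zero_right e)

/-- The divergence theorem for compactly supported fields of class `C¹`. -/
theorem integral_ctrace_fderiv {F : V → V} (hF : ContDiff ℝ 1 F) (hc : HasCompactSupport F) :
    ∫ x, ctrace (fderiv ℝ F x) = 0 := by
  simp only [ctrace_eq_sum_inner (stdOrthonormalBasis ℝ V), ← fderiv_inner_const_left hF]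
  rw [integral_finsetSum _ fun i _ => integrable_fderiv_apply (contDiff_inner_const_left hF _)
    (hasCompactSupport_inner_const_left hc _) _]
  exact Finset.sum_eq_zero fun i _ => integral_fderiv_apply_eq_zero
    (contDiff_inner_const_left hF _) (hasCompactSupport_inner_const_left hc _) _

theorem integrable_ctrace_fderiv_mul {F G : V → V} (hF : ContDiff ℝ 1 F) (hG : ContDiff ℝ 1 G)
    (hFc : HasCompactSupport F) :
    Integrable fun x => ctrace (fderiv ℝ F x) * ctrace (fderiv ℝ G x) :=
  ((continuous_ctrace.comp (hF.continuous_fderiv one_ne_zero)).mul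
    (continuous_ctrace.comp (hG.continuous_fderiv one_ne_zero))).integrable_of_hasCompactSupport
    ((hFc.fderiv ℝ).comp_left ctrace_zero).mul_right

theorem integrable_ctrace_fderiv_comp {F G : V → V} (hF : ContDiff ℝ 1 F) (hG : ContDiff ℝ 1 G)
    (hFc : HasCompactSupport F) :
    Integrable fun x => ctrace (fderiv ℝ F x ∘L fderiv ℝ G x) := by
  refine (continuous_ctrace.comp ((hF.continuous_fderiv one_ne_zero).clm_comp
    (hG.continuous_fderiv one_ne_zero))).integrable_of_hasCompactSupport ?_
  refine (hFc.fderiv ℝ).mono fun x hx => ?_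
  contrapose! hx
  simp only [Function.mem_support, not_not] at hx ⊢
  simp [hx, ctrace_zero]

/-- `∫ div F div G = ∫ tr (DF DG)` for compactly supported fields of class `C¹`. -/
theorem integral_ctrace_mul_sub_ctrace_comp {F G : V → V} (hF : ContDiff ℝ 1 F)
    (hG : ContDiff ℝ 1 G) (hFc : HasCompactSupport F) (hGc : HasCompactSupport G) :
    ∫ x, (ctrace (fderiv ℝ F x) * ctrace (fderiv ℝ G x)
      - ctrace (fderiv ℝ F x ∘L fderiv ℝ G x)) = 0 := by
  rw [integral_sub (integrable_ctrace_fderiv_mul hF hG hFc)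
    (integrable_ctrace_fderiv_comp hF hG hFc), sub_eq_zero]
  let b := stdOrthonormalBasis ℝ V
  have hint : ∀ e e' v w : V, Integrable fun x =>
      fderiv ℝ (fun y => ⟪e, F y⟫_ℝ) x v * fderiv ℝ (fun y => ⟪e', G y⟫_ℝ) x w := fun e e' v w =>
    ((((contDiff_inner_const_left hF e).continuous_fderiv one_ne_zero).clm_apply
      continuous_const).mul (((contDiff_inner_const_left hG e').continuous_fderiv
        one_ne_zero).clm_apply continuous_const)).integrable_of_hasCompactSupport
      (((hasCompactSupport_inner_const_left hFc e).fderiv_apply ℝ v).mul_right)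
  simp only [ctrace_eq_sum_inner b (fderiv ℝ _ _), ctrace_comp_eq_sum_inner b,
    ← fderiv_inner_const_left hF, ← fderiv_inner_const_left hG, Finset.sum_mul_sum]
  rw [integral_finsetSum _ fun i _ => integrable_finsetSum _ fun j _ => hint _ _ _ _,
    integral_finsetSum _ fun i _ => integrable_finsetSum _ fun j _ => hint _ _ _ _]
  refine Finset.sum_congr rfl fun i _ => ?_
  rw [integral_finsetSum _ fun j _ => hint _ _ _ _, integral_finsetSum _ fun j _ => hint _ _ _ _]
  exact Finset.sum_congr rfl fun j _ => integral_fderiv_mul_fderiv_comm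
    (contDiff_inner_const_left hF _) (contDiff_inner_const_left hG _)
    (hasCompactSupport_inner_const_left hFc _) (hasCompactSupport_inner_const_left hGc _) _ _

end IntegrationByParts
-- Power weights and the tangential part of a symmetric operator
section WeightedInequality

variable {V : Type*} [NormedAddCommGroup V] [InnerProductSpace ℝ V] [FiniteDimensional ℝ V]

theorem hasFDerivAt_norm_rpow_of_ne_zero {x : V} (hx : x ≠ 0) (a : ℝ) :
    HasFDerivAt (fun y : V => ‖y‖ ^ a) ((a * ‖x‖ ^ (a - 2)) • innerSL ℝ x) x := by
  have hx' : 0 < ‖x‖ := norm_pos_iff.2 hx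
  have h1 : HasFDerivAt (fun y : V => ‖y‖ ^ 2) (2 • innerSL ℝ x) x :=
    (hasStrictFDerivAt_norm_sq x).hasFDerivAt
  have h2 := h1.rpow_const (p := a / 2) (Or.inl (by positivity))
  have h3 : (fun y : V => ‖y‖ ^ a) = fun y => (‖y‖ ^ 2) ^ (a / 2) := by
    ext y
    rw [← Real.rpow_natCast, ← Real.rpow_mul (norm_nonneg y)]
    congr 1
    push_cast
    ring
  rw [h3]
  convert h2 using 1
  rw [← Real.rpow_natCast, ← Real.rpow_mul hx'.le, two_smul, ← two_smul ℝ, smul_smul]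
  congr 1
  rw [show ((2 : ℕ) : ℝ) * (a / 2 - 1) = a - 2 by push_cast; ring]
  ring

theorem contDiffAt_norm_rpow {x : V} (hx : x ≠ 0) (a : ℝ) {k : WithTop ℕ∞} :
    ContDiffAt ℝ k (fun y : V => ‖y‖ ^ a) x :=
  (contDiffAt_norm ℝ hx).rpow_const_of_ne (norm_ne_zero_iff.2 hx)

variable {W : Type*} [NormedAddCommGroup W] [NormedSpace ℝ W]

/-- The weights are singular only at the origin, where every field in question vanishes identically,
so weighting costs no regularity. -/
theorem contDiff_of_contDiffAt_of_eventuallyEq_zero {F : V → W} {k : WithTop ℕ∞}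
    (h0 : F =ᶠ[𝓝 0] 0) (h : ∀ x ≠ 0, ContDiffAt ℝ k F x) : ContDiff ℝ k F := by
  rw [contDiff_iff_contDiffAt]
  intro x
  by_cases hx : x = 0
  · subst hx
    exact (contDiffAt_const (c := (0 : W))).congr_of_eventuallyEq h0
  · exact h x hx

theorem contDiff_norm_rpow_smul {F : V → W} {k : WithTop ℕ∞} (hF : ContDiff ℝ k F)
    (h0 : F =ᶠ[𝓝 0] 0) (a : ℝ) : ContDiff ℝ k fun x => ‖x‖ ^ a • F x := by
  refine contDiff_of_contDiffAt_of_eventuallyEq_zero ?_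
    fun x hx => (contDiffAt_norm_rpow hx a).smul hF.contDiffAt
  filter_upwards [h0] with x hx
  simp [hx]

theorem continuous_norm_rpow_mul {f : V → ℝ} (hf : Continuous f) (h0 : f =ᶠ[𝓝 0] 0) (a : ℝ) :
    Continuous fun x => ‖x‖ ^ a * f x :=
  (contDiff_zero (𝕜 := ℝ)).1
    (by simpa using contDiff_norm_rpow_smul ((contDiff_zero (𝕜 := ℝ)).2 hf) h0 a)

theorem fderiv_norm_rpow_smul {F : V → W} (hF : ContDiff ℝ 1 F) {x : V} (hx : x ≠ 0) (a : ℝ) :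
    fderiv ℝ (fun y => ‖y‖ ^ a • F y) x =
      ‖x‖ ^ a • fderiv ℝ F x + ((a * ‖x‖ ^ (a - 2)) • innerSL ℝ x).smulRight (F x) :=
  ((hasFDerivAt_norm_rpow_of_ne_zero hx a).smul
    (hF.differentiable one_ne_zero x).hasFDerivAt).fderiv

theorem ctrace_fderiv_norm_rpow_smul {F : V → V} (hF : ContDiff ℝ 1 F) {x : V} (hx : x ≠ 0)
    (a : ℝ) : ctrace (fderiv ℝ (fun y => ‖y‖ ^ a • F y) x) =
      ‖x‖ ^ a * ctrace (fderiv ℝ F x) + a * ‖x‖ ^ (a - 2) * ⟪x, F x⟫_ℝ := by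
  rw [fderiv_norm_rpow_smul hF hx, ctrace_add, ctrace_smul, ctrace_smulRight]
  simp

theorem ctrace_smulRight_comp (f : V →L[ℝ] ℝ) (v : V) (A : V →L[ℝ] V) :
    ctrace (f.smulRight v ∘L A) = f (A v) := by
  have : f.smulRight v ∘L A = (f ∘L A).smulRight v := by ext; simp
  rw [this, ctrace_smulRight]
  rfl

theorem ctrace_fderiv_norm_rpow_smul_comp {F : V → V} (hF : ContDiff ℝ 1 F) {x : V} (hx : x ≠ 0)
    (a : ℝ) (A : V →L[ℝ] V) : ctrace (fderiv ℝ (fun y => ‖y‖ ^ a • F y) x ∘L A) =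
      ‖x‖ ^ a * ctrace (fderiv ℝ F x ∘L A) + a * ‖x‖ ^ (a - 2) * ⟪x, A (F x)⟫_ℝ := by
  rw [fderiv_norm_rpow_smul hF hx, ContinuousLinearMap.add_comp, ctrace_add,
    ContinuousLinearMap.smul_comp, ctrace_smul, ctrace_smulRight_comp]
  simp

/-- The square of the component of a symmetric operator tangential to the sphere through `x` is
nonnegative. -/
theorem tangential_sq_nonneg (M : V →L[ℝ] V) (hM : ∀ v w, ⟪M v, w⟫_ℝ = ⟪v, M w⟫_ℝ) (x : V) :
    0 ≤ ‖x‖ ^ 4 * ctrace (M ∘L M) - 2 * ‖x‖ ^ 2 * ‖M x‖ ^ 2 + ⟪x, M x⟫_ℝ ^ 2 := by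
  let b := stdOrthonormalBasis ℝ V
  by_cases hx : x = 0
  · simp [hx]
  have hx2 : 0 < ‖x‖ ^ 2 := by positivity
  have hself : ∀ v : V, ⟪v, v⟫_ℝ = ‖v‖ ^ 2 := real_inner_self_eq_norm_sq
  -- This is ‖x‖² times the orthogonal projection onto the complement of x, scaled to avoid
  -- division.
  let Q : V →L[ℝ] V := ‖x‖ ^ 2 • ContinuousLinearMap.id ℝ V - (innerSL ℝ x).smulRight x
  have hQa : ∀ y, Q y = ‖x‖ ^ 2 • y - ⟪x, y⟫_ℝ • x := fun y => by simp [Q]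
  have hQ : ∀ y, ‖Q y‖ ^ 2 = ‖x‖ ^ 4 * ‖y‖ ^ 2 - ‖x‖ ^ 2 * ⟪x, y⟫_ℝ ^ 2 := by
    intro y
    simp only [hQa, ← hself, inner_sub_left, inner_sub_right, inner_smul_left, inner_smul_right,
      real_inner_comm x y, RCLike.conj_to_real]
    simp only [hself]
    ring
  have htr : ctrace (M ∘L M) = ∑ i, ‖M (b i)‖ ^ 2 := by
    rw [ctrace_eq_sum_inner b]
    refine Finset.sum_congr rfl fun i _ => ?_
    rw [ContinuousLinearMap.comp_apply, ← hM, hself]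
  have hsum : ∑ i, ⟪x, M (b i)⟫_ℝ ^ 2 = ‖M x‖ ^ 2 := by
    rw [← b.sum_sq_norm_inner_left (M x)]
    refine Finset.sum_congr rfl fun i _ => ?_
    rw [← hM, Real.norm_eq_abs, sq_abs]
  have hQM : Q (M x) = ∑ i, ⟪b i, x⟫_ℝ • Q (M (b i)) := by
    have := congrArg (fun z => Q (M z)) (b.sum_repr' x)
    simpa only [map_sum, map_smul] using this.symm
  -- The norm of QM at x is bounded by its Hilbert-Schmidt norm; expanded, this is the claim
  -- multiplied by ‖x‖².
  have hcs : ‖Q (M x)‖ ^ 2 ≤ ‖x‖ ^ 2 * ∑ i, ‖Q (M (b i))‖ ^ 2 := by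
    rw [hQM, ← b.sum_sq_norm_inner_right x]
    refine le_trans (pow_le_pow_left₀ (norm_nonneg _) (norm_sum_le _ _) 2) ?_
    simp only [norm_smul]
    exact Finset.sum_mul_sq_le_sq_mul_sq _ _ _
  simp only [hQ, Finset.sum_sub_distrib, ← Finset.mul_sum, hsum, ← htr] at hcs
  have : 0 ≤ ‖x‖ ^ 2 * (‖x‖ ^ 4 * ctrace (M ∘L M) - 2 * ‖x‖ ^ 2 * ‖M x‖ ^ 2
      + ⟪x, M x⟫_ℝ ^ 2) := by linarith
  exact nonneg_of_mul_nonneg_right this hx2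

/-- Cauchy-Schwarz for the trace of the tangential component of a symmetric operator. -/
theorem sq_tangential_trace_le (H : V →L[ℝ] V) (hH : ∀ v w, ⟪H v, w⟫_ℝ = ⟪v, H w⟫_ℝ) (x : V)
    (hd : 1 < Module.finrank ℝ V) :
    (‖x‖ ^ 2 * ctrace H - ⟪x, H x⟫_ℝ) ^ 2 ≤ ((Module.finrank ℝ V : ℝ) - 1) *
      (‖x‖ ^ 4 * ctrace (H ∘L H) - 2 * ‖x‖ ^ 2 * ‖H x‖ ^ 2 + ⟪x, H x⟫_ℝ ^ 2) := by
  by_cases hx : x = 0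
  · simp [hx]
  have hx2 : 0 < ‖x‖ ^ 2 := by positivity
  have hd' : (0 : ℝ) < (Module.finrank ℝ V : ℝ) - 1 := by
    rw [sub_pos]; exact_mod_cast hd
  set m : ℝ := (Module.finrank ℝ V : ℝ) - 1 with hm
  -- The mean of the tangential eigenvalues. Subtracting it leaves the trace-free tangential part,
  -- whose square is nonnegative.
  set l : ℝ := (‖x‖ ^ 2 * ctrace H - ⟪x, H x⟫_ℝ) / (m * ‖x‖ ^ 2) with hl
  have hl' : ‖x‖ ^ 2 * ctrace H - ⟪x, H x⟫_ℝ = l * (m * ‖x‖ ^ 2) := by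
    rw [hl]; field_simp
  have key := tangential_sq_nonneg (H - l • ContinuousLinearMap.id ℝ V)
    (fun v w => by simp [inner_sub_left, inner_sub_right, hH, inner_smul_left, inner_smul_right]) x
  have h1 : ctrace ((H - l • ContinuousLinearMap.id ℝ V) ∘L (H - l • ContinuousLinearMap.id ℝ V)) =
      ctrace (H ∘L H) - 2 * l * ctrace H + l ^ 2 * (m + 1) := by
    have : (H - l • ContinuousLinearMap.id ℝ V) ∘L (H - l • ContinuousLinearMap.id ℝ V) =
        H ∘L H + ((-2 * l) • H + (l ^ 2) • ContinuousLinearMap.id ℝ V) := by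
      ext v; simp; module
    rw [this, ctrace_add, ctrace_add, ctrace_smul, ctrace_smul, ctrace_id, hm]
    ring
  have h2 : ‖(H - l • ContinuousLinearMap.id ℝ V) x‖ ^ 2 =
      ‖H x‖ ^ 2 - 2 * l * ⟪x, H x⟫_ℝ + l ^ 2 * ‖x‖ ^ 2 := by
    have : (H - l • ContinuousLinearMap.id ℝ V) x = H x - l • x := by simp
    rw [this, norm_sub_sq_real, norm_smul, inner_smul_right, mul_pow, Real.norm_eq_abs, sq_abs,
      real_inner_comm]
    ring
  have h3 : ⟪x, (H - l • ContinuousLinearMap.id ℝ V) x⟫_ℝ = ⟪x, H x⟫_ℝ - l * ‖x‖ ^ 2 := by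
    simp [inner_sub_right, inner_smul_right]
  rw [h1, h2, h3] at key
  rw [hl']
  have h4 : ‖x‖ ^ 2 * ctrace H = l * (m * ‖x‖ ^ 2) + ⟪x, H x⟫_ℝ := by linarith
  have key2 : 0 ≤ (‖x‖ ^ 4 * ctrace (H ∘L H) - 2 * ‖x‖ ^ 2 * ‖H x‖ ^ 2 + ⟪x, H x⟫_ℝ ^ 2)
      - m * (l * ‖x‖ ^ 2) ^ 2 := by
    refine le_of_le_of_eq key ?_
    linear_combination (-2 * l * ‖x‖ ^ 2) * h4
  have := mul_nonneg hd'.le key2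
  linarith

end WeightedInequality
-- The weighted inequality for fields with symmetric derivative
section FieldInequality

variable {V : Type*} [NormedAddCommGroup V] [InnerProductSpace ℝ V] [FiniteDimensional ℝ V]

theorem fderiv_inner_id {g : V → V} (hg : ContDiff ℝ 1 g) (x v : V) :
    fderiv ℝ (fun y => ⟪y, g y⟫_ℝ) x v = ⟪x, fderiv ℝ g x v⟫_ℝ + ⟪v, g x⟫_ℝ := by
  rw [fderiv_inner_apply ℝ differentiableAt_fun_id (hg.differentiable one_ne_zero x)]
  simp

theorem fderiv_smul_field {f : V → ℝ} {G : V → V} (hf : ContDiff ℝ 1 f) (hG : ContDiff ℝ 1 G)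
    (x : V) : fderiv ℝ (fun y => f y • G y) x =
      f x • fderiv ℝ G x + (fderiv ℝ f x).smulRight (G x) :=
  ((hf.differentiable one_ne_zero x).hasFDerivAt.smul
    (hG.differentiable one_ne_zero x).hasFDerivAt).fderiv

theorem hasCompactSupport_norm_rpow_smul {F : V → V} (hF : HasCompactSupport F) (a : ℝ) :
    HasCompactSupport fun x => ‖x‖ ^ a • F x :=
  hF.smul_left (f := fun x : V => ‖x‖ ^ a)

theorem norm_rpow_sub_two {x : V} (hx : x ≠ 0) (a : ℝ) : ‖x‖ ^ (a - 2) = ‖x‖ ^ a / ‖x‖ ^ 2 := by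
  rw [Real.rpow_sub (norm_pos_iff.2 hx)]
  norm_cast

/-- The pointwise inequality behind the weighted Rellich inequality: up to a sum of squares, the
difference of the densities is a combination of divergences. Here `R = ‖x‖ ^ 2`, `t` and `k` are
the traces of `H` and `H ^ 2`, and `s = ⟪x, g⟫`, `h = ⟪x, H x⟫`, `p = ⟪x, H g⟫`, `q = ‖H x‖ ^ 2`,
`G = ‖g‖ ^ 2`. -/
theorem density_inequality {n R t k s h p q G : ℝ} (hn : 2 < n)
    (hcs : (s + h) ^ 2 ≤ R * (G + 2 * p + q))
    (htan : (R * t - h) ^ 2 ≤ (n - 1) * (R ^ 2 * k - 2 * R * q + h ^ 2)) :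
    2 * (2 * s * (s + h)) + (1 - n - 1 / (n - 2)) * (2 * R * G + 2 * R * p)
      + (n - 3 + 2 / (n - 2)) * ((2 - n) * s ^ 2 + R * (G + p + s * t))
      + (-2 / (n - 2)) * (R * (2 * s * t + h * t - p - q) - (2 - n) * s * h)
      + ((n - 1) / (n - 2)) * ((4 - n) * R * (s * t - p) + R ^ 2 * (t ^ 2 - k))
    ≤ R ^ 2 * t ^ 2 - ((n - 2) ^ 2 * s ^ 2 + (n - 1) * (R * G - s ^ 2)) := by
  have hn2 : 0 < n - 2 := by linarith
  -- The exact remainder. Since g + Hx = ∇⟨x, g⟩, the first two terms are the squared radial and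
  -- tangential parts of that gradient, up to factors; the third is the Cauchy-Schwarz defect of the
  -- tangential trace.
  have h1 : 0 ≤ (h + s) ^ 2 + 2 * (R * (G + 2 * p + q) - (s + h) ^ 2) +
      ((n - 1) * (R ^ 2 * k - 2 * R * q + h ^ 2) - (R * t - h) ^ 2) / (n - 2) :=
    add_nonneg (add_nonneg (sq_nonneg _) (by linarith)) (div_nonneg (by linarith) hn2.le)
  rw [← sub_nonneg]
  refine le_of_le_of_eq h1 ?_
  field_simp
  ring

variable [MeasurableSpace V] [BorelSpace V]

/-- The weighted Rellich inequality with the sharp angular constant, for fields with symmetric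
derivative. -/
theorem weighted_field_inequality {g : V → V} (hg : ContDiff ℝ 1 g) (hgc : HasCompactSupport g)
    (h0 : g =ᶠ[𝓝 0] 0) (hsym : ∀ x v w, ⟪fderiv ℝ g x v, w⟫_ℝ = ⟪v, fderiv ℝ g x w⟫_ℝ)
    {n : ℝ} (hdim : (Module.finrank ℝ V : ℝ) = n) (hn : 2 < n) :
    (n - 2) ^ 2 * (∫ x, ‖x‖ ^ (-n) * ⟪x, g x⟫_ℝ ^ 2)
      + (n - 1) * ((∫ x, ‖x‖ ^ (2 - n) * ‖g x‖ ^ 2) - ∫ x, ‖x‖ ^ (-n) * ⟪x, g x⟫_ℝ ^ 2)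
    ≤ ∫ x, ‖x‖ ^ (4 - n) * ctrace (fderiv ℝ g x) ^ 2 := by
  have hd1 : 1 < Module.finrank ℝ V := by
    have : (1 : ℝ) < Module.finrank ℝ V := by rw [hdim]; linarith
    exact_mod_cast this
  have : Nontrivial V := Module.nontrivial_of_finrank_pos (R := ℝ) (by omega)
  have hs : ContDiff ℝ 1 fun x => ⟪x, g x⟫_ℝ := contDiff_id.inner ℝ hg
  have hG : ContDiff ℝ 1 fun x => ‖g x‖ ^ 2 := hg.norm_sq ℝ
  have hs0 : (fun x => ⟪x, g x⟫_ℝ) =ᶠ[𝓝 0] 0 := by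
    filter_upwards [h0] with x hx; simp [hx]
  have hG0 : (fun x => ‖g x‖ ^ 2) =ᶠ[𝓝 0] 0 := by
    filter_upwards [h0] with x hx; simp [hx]
  have hGc : HasCompactSupport fun x => ‖g x‖ ^ 2 :=
    hgc.mono fun x hx => by contrapose! hx; simp_all
  have hH0 : (fderiv ℝ g) =ᶠ[𝓝 0] 0 := by
    have := h0.fderiv (𝕜 := ℝ)
    filter_upwards [this] with x hx
    rw [hx]; simp
  -- the fields whose divergences occur
  set A : V → V := fun x => ⟪x, g x⟫_ℝ ^ 2 • x with hAdef
  set B : V → V := fun x => ‖g x‖ ^ 2 • x with hBdef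
  set C : V → V := fun x => ⟪x, g x⟫_ℝ • g x with hCdef
  set D : V → V := fun x => ⟪x, g x⟫_ℝ • x with hDdef
  have hA : ContDiff ℝ 1 A := (hs.pow 2).smul contDiff_id
  have hB : ContDiff ℝ 1 B := hG.smul contDiff_id
  have hC : ContDiff ℝ 1 C := hs.smul hg
  have hD : ContDiff ℝ 1 D := hs.smul contDiff_id
  have hA0 : A =ᶠ[𝓝 0] 0 := by filter_upwards [h0] with x hx; simp [hAdef, hx]
  have hB0 : B =ᶠ[𝓝 0] 0 := by filter_upwards [h0] with x hx; simp [hBdef, hx]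
  have hC0 : C =ᶠ[𝓝 0] 0 := by filter_upwards [h0] with x hx; simp [hCdef, hx]
  have hD0 : D =ᶠ[𝓝 0] 0 := by filter_upwards [h0] with x hx; simp [hDdef, hx]
  have hAc : HasCompactSupport A := hgc.mono fun x hx => by contrapose! hx; simp_all
  have hBc : HasCompactSupport B := hgc.mono fun x hx => by contrapose! hx; simp_all
  have hCc : HasCompactSupport C := hgc.mono fun x hx => by contrapose! hx; simp_all
  have hDc : HasCompactSupport D := hgc.mono fun x hx => by contrapose! hx; simp_all
  have cA := contDiff_norm_rpow_smul hA hA0 (-n)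
  have cB := contDiff_norm_rpow_smul hB hB0 (2 - n)
  have cC := contDiff_norm_rpow_smul hC hC0 (2 - n)
  have cD := contDiff_norm_rpow_smul hD hD0 (2 - n)
  have cE := contDiff_norm_rpow_smul hg h0 (4 - n)
  have kA := hasCompactSupport_norm_rpow_smul hAc (-n)
  have kB := hasCompactSupport_norm_rpow_smul hBc (2 - n)
  have kC := hasCompactSupport_norm_rpow_smul hCc (2 - n)
  have kD := hasCompactSupport_norm_rpow_smul hDc (2 - n)
  have kE := hasCompactSupport_norm_rpow_smul hgc (4 - n)
  -- The five integrands of zero integral, with the coefficients of `density_inequality`: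
  -- divergences for A, B, C, and null Lagrangians paired with g for D and for g itself.
  let fA : V → ℝ := fun x => 2 * ctrace (fderiv ℝ (fun y => ‖y‖ ^ (-n) • A y) x)
  let fB : V → ℝ := fun x =>
    (1 - n - 1 / (n - 2)) * ctrace (fderiv ℝ (fun y => ‖y‖ ^ (2 - n) • B y) x)
  let fC : V → ℝ := fun x =>
    (n - 3 + 2 / (n - 2)) * ctrace (fderiv ℝ (fun y => ‖y‖ ^ (2 - n) • C y) x)
  let fD : V → ℝ := fun x => (-2 / (n - 2)) *
    (ctrace (fderiv ℝ (fun y => ‖y‖ ^ (2 - n) • D y) x) * ctrace (fderiv ℝ g x)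
      - ctrace (fderiv ℝ (fun y => ‖y‖ ^ (2 - n) • D y) x ∘L fderiv ℝ g x))
  let fE : V → ℝ := fun x => ((n - 1) / (n - 2)) *
    (ctrace (fderiv ℝ (fun y => ‖y‖ ^ (4 - n) • g y) x) * ctrace (fderiv ℝ g x)
      - ctrace (fderiv ℝ (fun y => ‖y‖ ^ (4 - n) • g y) x ∘L fderiv ℝ g x))
  have iA : Integrable fA := (integrable_ctrace_fderiv cA kA).const_mul _
  have iB : Integrable fB := (integrable_ctrace_fderiv cB kB).const_mul _
  have iC : Integrable fC := (integrable_ctrace_fderiv cC kC).const_mul _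
  have iD : Integrable fD := ((integrable_ctrace_fderiv_mul cD hg kD).sub
    (integrable_ctrace_fderiv_comp cD hg kD)).const_mul _
  have iE : Integrable fE := ((integrable_ctrace_fderiv_mul cE hg kE).sub
    (integrable_ctrace_fderiv_comp cE hg kE)).const_mul _
  have zA : ∫ x, fA x = 0 := by
    simp only [fA, integral_const_mul, integral_ctrace_fderiv cA kA, mul_zero]
  have zB : ∫ x, fB x = 0 := by
    simp only [fB, integral_const_mul, integral_ctrace_fderiv cB kB, mul_zero]
  have zC : ∫ x, fC x = 0 := by
    simp only [fC, integral_const_mul, integral_ctrace_fderiv cC kC, mul_zero]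
  have zD : ∫ x, fD x = 0 := by
    simp only [fD, integral_const_mul, integral_ctrace_mul_sub_ctrace_comp cD hg kD hgc, mul_zero]
  have zE : ∫ x, fE x = 0 := by
    simp only [fE, integral_const_mul, integral_ctrace_mul_sub_ctrace_comp cE hg kE hgc, mul_zero]
  have i1 : Integrable fun x => ‖x‖ ^ (4 - n) * ctrace (fderiv ℝ g x) ^ 2 := by
    refine Continuous.integrable_of_hasCompactSupport (continuous_norm_rpow_mul
      ((continuous_ctrace.comp (hg.continuous_fderiv one_ne_zero)).pow 2) ?_ _) ?_
    · filter_upwards [hH0] with x hx; simp [hx, ctrace_zero]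
    · refine (hgc.fderiv ℝ).mono fun x hx => ?_
      contrapose! hx
      simp only [Function.mem_support, not_not] at hx ⊢
      simp [hx, ctrace_zero]
  have i2 : Integrable fun x => ‖x‖ ^ (-n) * ⟪x, g x⟫_ℝ ^ 2 :=
    Continuous.integrable_of_hasCompactSupport (continuous_norm_rpow_mul (hs.continuous.pow 2)
      (by filter_upwards [hs0] with x hx; simp_all) _)
      (hgc.mono fun x hx => by contrapose! hx; simp_all)
  have i3 : Integrable fun x => ‖x‖ ^ (2 - n) * ‖g x‖ ^ 2 :=
    Continuous.integrable_of_hasCompactSupport (continuous_norm_rpow_mul hG.continuous hG0 _)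
      hGc.mul_left
  let f1 : V → ℝ := fun x => ‖x‖ ^ (4 - n) * ctrace (fderiv ℝ g x) ^ 2
  let f2 : V → ℝ := fun x => (n - 2) ^ 2 * (‖x‖ ^ (-n) * ⟪x, g x⟫_ℝ ^ 2)
  let f3 : V → ℝ := fun x =>
    (n - 1) * (‖x‖ ^ (2 - n) * ‖g x‖ ^ 2 - ‖x‖ ^ (-n) * ⟪x, g x⟫_ℝ ^ 2)
  have j1 : Integrable f1 := i1
  have j2 : Integrable f2 := i2.const_mul _
  have j3 : Integrable f3 := (i3.sub i2).const_mul _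
  have hz : ∫ x, (fA + fB + fC + fD + fE) x = 0 := by
    rw [integral_add' (((iA.add iB).add iC).add iD) iE, integral_add' ((iA.add iB).add iC) iD,
      integral_add' (iA.add iB) iC, integral_add' iA iB, zA, zB, zC, zD, zE]
    simp
  have hle : 0 ≤ ∫ x, (f1 - (f2 + f3)) x := by
    rw [← hz]
    refine integral_mono_ae ((((iA.add iB).add iC).add iD).add iE) (j1.sub (j2.add j3)) ?_
    have hae : ∀ᵐ x : V, x ≠ 0 := by
      simp [ae_iff, measure_singleton]
    filter_upwards [hae] with x hx
    have hr : 0 < ‖x‖ := norm_pos_iff.2 hx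
    have hR : ‖x‖ ^ 2 ≠ 0 := by positivity
    set H := fderiv ℝ g x with hHdef
    have e2 : ‖x‖ ^ (2 - n) = ‖x‖ ^ (-n) * ‖x‖ ^ 2 := by
      rw [sub_eq_add_neg, add_comm, Real.rpow_add hr]; norm_cast
    have e4 : ‖x‖ ^ (4 - n) = ‖x‖ ^ (-n) * (‖x‖ ^ 2) ^ 2 := by
      rw [sub_eq_add_neg, add_comm, Real.rpow_add hr, ← pow_mul]; norm_cast
    have dg : fderiv ℝ (fun y => ‖g y‖ ^ 2) x = 2 • (innerSL ℝ (g x)) ∘L H :=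
      ((hg.differentiable one_ne_zero x).hasFDerivAt.norm_sq).fderiv
    have ds2 : ∀ v, fderiv ℝ (fun y => ⟪y, g y⟫_ℝ ^ 2) x v =
        2 * ⟪x, g x⟫_ℝ * (⟪x, H v⟫_ℝ + ⟪v, g x⟫_ℝ) := by
      intro v
      rw [fderiv_fun_pow 2 (hs.differentiable one_ne_zero x)]
      simp [fderiv_inner_id hg, hHdef]
    have hid : fderiv ℝ (fun y : V => y) x = ContinuousLinearMap.id ℝ V := fderiv_fun_id
    have dA : fderiv ℝ A x = _ := fderiv_smul_field (hs.pow 2) (G := fun y : V => y) contDiff_id x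
    have dB : fderiv ℝ B x = _ := fderiv_smul_field hG (G := fun y : V => y) contDiff_id x
    have dC : fderiv ℝ C x = _ := fderiv_smul_field hs hg x
    have dD : fderiv ℝ D x = _ := fderiv_smul_field hs (G := fun y : V => y) contDiff_id x
    have hpx : ⟪H x, g x⟫_ℝ = ⟪x, H (g x)⟫_ℝ := hsym x x (g x)
    have hgHx : ⟪g x, H x⟫_ℝ = ⟪x, H (g x)⟫_ℝ := by rw [real_inner_comm, hpx]
    have hHH : ⟪x, H (H x)⟫_ℝ = ‖H x‖ ^ 2 := by rw [← hsym, real_inner_self_eq_norm_sq]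
    have tA : ctrace (fderiv ℝ A x) = n * ⟪x, g x⟫_ℝ ^ 2
        + 2 * ⟪x, g x⟫_ℝ * (⟪x, H x⟫_ℝ + ⟪x, g x⟫_ℝ) := by
      rw [dA, ctrace_add, ctrace_smul, ctrace_smulRight, ds2]
      simp only [hid, ctrace_id, hdim]
      ring
    have tB : ctrace (fderiv ℝ B x) = n * ‖g x‖ ^ 2 + 2 * ⟪x, H (g x)⟫_ℝ := by
      rw [dB, ctrace_add, ctrace_smul, ctrace_smulRight, dg]
      simp [hid, ctrace_id, hdim, hgHx]
      ring
    have tC : ctrace (fderiv ℝ C x) = ⟪x, g x⟫_ℝ * ctrace H + ⟪x, H (g x)⟫_ℝ + ‖g x‖ ^ 2 := by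
      rw [dC, ctrace_add, ctrace_smul, ctrace_smulRight, fderiv_inner_id hg,
        real_inner_self_eq_norm_sq]
      ring
    have tD : ctrace (fderiv ℝ D x) = n * ⟪x, g x⟫_ℝ + ⟪x, H x⟫_ℝ + ⟪x, g x⟫_ℝ := by
      rw [dD, ctrace_add, ctrace_smul, ctrace_smulRight, fderiv_inner_id hg]
      simp only [hid, ctrace_id, hdim]
      ring
    have tDH : ctrace (fderiv ℝ D x ∘L H) =
        ⟪x, g x⟫_ℝ * ctrace H + ‖H x‖ ^ 2 + ⟪x, H (g x)⟫_ℝ := by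
      rw [dD, ContinuousLinearMap.add_comp, ctrace_add, ContinuousLinearMap.smul_comp,
        ctrace_smul, ctrace_smulRight_comp, fderiv_inner_id hg]
      simp only [hid, ContinuousLinearMap.id_comp]
      rw [← hHdef, hHH, hpx]
      ring
    have xA : ⟪x, A x⟫_ℝ = ⟪x, g x⟫_ℝ ^ 2 * ‖x‖ ^ 2 := by
      rw [hAdef, inner_smul_right, real_inner_self_eq_norm_sq]
    have xB : ⟪x, B x⟫_ℝ = ‖g x‖ ^ 2 * ‖x‖ ^ 2 := by
      rw [hBdef, inner_smul_right, real_inner_self_eq_norm_sq]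
    have xC : ⟪x, C x⟫_ℝ = ⟪x, g x⟫_ℝ ^ 2 := by
      rw [hCdef, inner_smul_right, sq]
    have xD : ⟪x, D x⟫_ℝ = ⟪x, g x⟫_ℝ * ‖x‖ ^ 2 := by
      rw [hDdef, inner_smul_right, real_inner_self_eq_norm_sq]
    have xHD : ⟪x, H (D x)⟫_ℝ = ⟪x, g x⟫_ℝ * ⟪x, H x⟫_ℝ := by
      rw [hDdef, map_smul, inner_smul_right]
    -- Cauchy-Schwarz for x and g + Hx.
    have hcs : (⟪x, g x⟫_ℝ + ⟪x, H x⟫_ℝ) ^ 2 ≤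
        ‖x‖ ^ 2 * (‖g x‖ ^ 2 + 2 * ⟪x, H (g x)⟫_ℝ + ‖H x‖ ^ 2) := by
      rw [← inner_add_right, ← hgHx, ← norm_add_sq_real, ← mul_pow, ← sq_abs]
      exact pow_le_pow_left₀ (abs_nonneg _) (abs_real_inner_le_norm _ _) 2
    have htan := sq_tangential_trace_le H (hsym x) x hd1
    rw [hdim, show ‖x‖ ^ 4 = (‖x‖ ^ 2) ^ 2 by ring] at htan
    have key := mul_le_mul_of_nonneg_left (density_inequality hn hcs htan)
      (Real.rpow_nonneg hr.le (-n))
    simp only [Pi.add_apply, Pi.sub_apply, fA, fB, fC, fD, fE, f1, f2, f3]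
    rw [ctrace_fderiv_norm_rpow_smul hA hx, ctrace_fderiv_norm_rpow_smul hB hx,
      ctrace_fderiv_norm_rpow_smul hC hx, ctrace_fderiv_norm_rpow_smul hD hx,
      ctrace_fderiv_norm_rpow_smul hg hx, ctrace_fderiv_norm_rpow_smul_comp hD hx,
      ctrace_fderiv_norm_rpow_smul_comp hg hx, tA, tB, tC, tD, tDH, xA, xB, xC, xD, xHD]
    simp only [norm_rpow_sub_two hx, ← hHdef, e2, e4]
    refine le_of_eq_of_le ?_ (key.trans_eq ?_)
    · generalize ‖x‖ ^ (-n) = ρ at *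
      field_simp
      ring
    · ring
  rw [integral_sub' j1 (j2.add j3), integral_add' j2 j3] at hle
  simp only [f1, f2, f3, integral_const_mul] at hle
  rw [integral_sub i3 i2] at hle
  linarith

end FieldInequality
-- Gradient fields of C² functions
section Gradient

variable {V : Type*} [NormedAddCommGroup V] [InnerProductSpace ℝ V] [FiniteDimensional ℝ V]

theorem contDiff_gradient {u : V → ℝ} (hu : ContDiff ℝ 2 u) : ContDiff ℝ 1 (gradient u) :=
  (toDual ℝ V).symm.contDiff.comp (hu.fderiv_right (m := 1) (by norm_num))

theorem hasCompactSupport_gradient {u : V → ℝ} (hu : HasCompactSupport u) :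
    HasCompactSupport (gradient u) :=
  (hu.fderiv ℝ).comp_left (g := (toDual ℝ V).symm) (map_zero _)

theorem gradient_eventuallyEq_zero {u : V → ℝ} (hu : (0 : V) ∉ tsupport u) :
    gradient u =ᶠ[𝓝 0] 0 := by
  have := (notMem_tsupport_iff_eventuallyEq.1 hu).fderiv (𝕜 := ℝ)
  filter_upwards [this] with x hx
  rw [gradient, hx]
  simp

theorem inner_fderiv_gradient {u : V → ℝ} (hu : ContDiff ℝ 2 u) (x v w : V) :
    ⟪fderiv ℝ (gradient u) x v, w⟫_ℝ = fderiv ℝ (fderiv ℝ u) x v w := by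
  have h1 : DifferentiableAt ℝ (gradient u) x :=
    (contDiff_gradient hu).differentiable one_ne_zero x
  have h2 : DifferentiableAt ℝ (fderiv ℝ u) x :=
    (hu.fderiv_right (m := 1) (by norm_num)).differentiable one_ne_zero x
  have h3 : (fun y => ⟪gradient u y, w⟫_ℝ) = fun y => fderiv ℝ u y w := by
    ext y; exact inner_gradient_left
  have h4 := fderiv_inner_apply ℝ h1 (differentiableAt_const w) v
  rw [h3, fderiv_clm_apply h2 (differentiableAt_const w)] at h4
  simpa using h4.symm

theorem inner_fderiv_gradient_comm {u : V → ℝ} (hu : ContDiff ℝ 2 u) (x v w : V) :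
    ⟪fderiv ℝ (gradient u) x v, w⟫_ℝ = ⟪v, fderiv ℝ (gradient u) x w⟫_ℝ := by
  rw [real_inner_comm _ v, inner_fderiv_gradient hu, inner_fderiv_gradient hu]
  exact (hu.contDiffAt.isSymmSndFDerivAt (by simp)) v w

theorem laplacian_eq_ctrace {u : V → ℝ} (hu : ContDiff ℝ 2 u) (x : V) :
    Laplacian.laplacian u x = ctrace (fderiv ℝ (gradient u) x) := by
  rw [laplacian_eq_iteratedFDeriv_stdOrthonormalBasis, ctrace_eq_sum_inner (stdOrthonormalBasis ℝ V)]
  refine Finset.sum_congr rfl fun i _ => ?_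
  rw [real_inner_comm, inner_fderiv_gradient hu, iteratedFDeriv_two_apply]
  rfl

/-- A radial function has a radial gradient. -/
theorem norm_sq_mul_norm_gradient_sq {u : V → ℝ} (hu : Differentiable ℝ u)
    (hrad : ∀ x y : V, ‖x‖ = ‖y‖ → u x = u y) (x : V) :
    ‖x‖ ^ 2 * ‖gradient u x‖ ^ 2 = ⟪x, gradient u x⟫_ℝ ^ 2 := by
  have horth : ∀ v : V, ⟪x, v⟫_ℝ = 0 → ⟪gradient u x, v⟫_ℝ = 0 := by
    intro v hv
    rw [inner_gradient_left]
    have hl : ∀ w : V, HasDerivAt (fun t : ℝ => u (x + t • w)) (fderiv ℝ u x w) 0 := fun w =>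
      (hu x).hasFDerivAt.hasLineDerivAt w
    -- For v orthogonal to x the points x ± tv have equal norm, so the derivative along v equals its
    -- own negative.
    have heq : (fun t : ℝ => u (x + t • v)) = fun t : ℝ => u (x + t • (-v)) := by
      ext t
      apply hrad
      rw [← sq_eq_sq₀ (norm_nonneg _) (norm_nonneg _), norm_add_sq_real, norm_add_sq_real]
      simp [inner_smul_right, hv]
    have h1 := hl v
    rw [heq] at h1
    have h2 := h1.unique (hl (-v))
    rw [map_neg] at h2
    linarith
  set g := gradient u x
  -- The test vector is ‖x‖² times the tangential component of the gradient.
  have h := horth (‖x‖ ^ 2 • g - ⟪x, g⟫_ℝ • x) (by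
    rw [inner_sub_right, inner_smul_right, inner_smul_right, real_inner_self_eq_norm_sq]; ring)
  rw [inner_sub_right, inner_smul_right, inner_smul_right, real_inner_self_eq_norm_sq,
    real_inner_comm x g] at h
  linarith

end Gradient

/-! ### Lower bounds for both constants -/

section LowerBound

variable {n : ℕ}

/-- A function with zero gradient is constant, hence zero because it vanishes at the origin. Thus no
quotient takes the default value 0 of division by zero. -/
theorem gradientEnergy_pos (α : ℝ) {u : EuclideanSpace ℝ (Fin n) → ℝ}
    (hu : u ∈ TestFunctions n) : 0 < gradientEnergy α u := by
  obtain ⟨h1, h2, h3, h4⟩ := hu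
  have hg := contDiff_gradient h1
  have hg0 := gradient_eventuallyEq_zero h3
  have hx : ∃ x, gradient u x ≠ 0 := by
    by_contra! hcon
    have hfd : ∀ x, fderiv ℝ u x = 0 := fun x => by
      rw [← toDual_gradient, hcon x, map_zero]
    have hconst := is_const_of_fderiv_eq_zero (h1.differentiable two_ne_zero) hfd
    apply h4
    ext x
    rw [hconst x 0]
    exact image_eq_zero_of_notMem_tsupport h3
  obtain ⟨x, hx⟩ := hx
  have hx0 : x ≠ 0 := by
    rintro rfl
    exact hx hg0.self_of_nhds
  refine Continuous.integral_pos_of_hasCompactSupport_nonneg_nonzero (x := x)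
    (continuous_norm_rpow_mul (hg.continuous.norm.pow 2)
      (by filter_upwards [hg0] with y hy; simp [hy]) _) ?_ (fun y => by positivity) ?_
  · refine HasCompactSupport.mul_left ?_
    exact (hasCompactSupport_gradient h2).mono fun y hy => by contrapose! hy; simp_all
  · have : 0 < ‖x‖ := norm_pos_iff.2 hx0
    have : 0 < ‖gradient u x‖ := norm_pos_iff.2 hx
    positivity

/-- The weighted Rellich inequality in dimension at least three. -/
theorem radial_add_angular_energy_le (hn : 3 ≤ n) {u : EuclideanSpace ℝ (Fin n) → ℝ}
    (hu : u ∈ TestFunctions n) :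
    ((n : ℝ) - 2) ^ 2 * (∫ x, ‖x‖ ^ (-(n : ℝ)) * ⟪x, gradient u x⟫_ℝ ^ 2)
      + ((n : ℝ) - 1) * (gradientEnergy (4 - (n : ℝ)) u
        - ∫ x, ‖x‖ ^ (-(n : ℝ)) * ⟪x, gradient u x⟫_ℝ ^ 2)
    ≤ laplacianEnergy (4 - (n : ℝ)) u := by
  obtain ⟨h1, h2, h3, -⟩ := hu
  have hn' : (2 : ℝ) < n := by exact_mod_cast hn
  have h := weighted_field_inequality (contDiff_gradient h1) (hasCompactSupport_gradient h2)
    (gradient_eventuallyEq_zero h3) (inner_fderiv_gradient_comm h1) (n := n) (by simp) hn'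
  unfold laplacianEnergy gradientEnergy
  simp only [laplacian_eq_ctrace h1]
  rwa [show (4 - (n : ℝ) - 2) = 2 - n by ring]

theorem norm_rpow_two_sub {x : EuclideanSpace ℝ (Fin n)} (hx : x ≠ 0) (c : ℝ) :
    ‖x‖ ^ (4 - c - 2) = ‖x‖ ^ (-c) * ‖x‖ ^ 2 := by
  rw [show 4 - c - 2 = -c + 2 by ring, Real.rpow_add (norm_pos_iff.2 hx)]
  norm_cast

theorem integrable_gradient_density (α : ℝ) {u : EuclideanSpace ℝ (Fin n) → ℝ}
    (hu : u ∈ TestFunctions n) : Integrable fun x => ‖x‖ ^ (α - 2) * ‖gradient u x‖ ^ 2 := by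
  have hg0 := gradient_eventuallyEq_zero hu.2.2.1
  refine Continuous.integrable_of_hasCompactSupport
    (continuous_norm_rpow_mul ((contDiff_gradient hu.1).continuous.norm.pow 2) ?_ _) ?_
  · filter_upwards [hg0] with y hy; simp [hy]
  · exact (hasCompactSupport_gradient hu.2.1).mono fun y hy => by contrapose! hy; simp_all

theorem integrable_laplacian_density (α : ℝ) {u : EuclideanSpace ℝ (Fin n) → ℝ}
    (hu : u ∈ TestFunctions n) :
    Integrable fun x => ‖x‖ ^ α * Laplacian.laplacian u x ^ 2 := by
  have hg := contDiff_gradient hu.1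
  have hH0 := (gradient_eventuallyEq_zero hu.2.2.1).fderiv (𝕜 := ℝ)
  simp only [laplacian_eq_ctrace hu.1]
  refine Continuous.integrable_of_hasCompactSupport (continuous_norm_rpow_mul
    ((continuous_ctrace.comp (hg.continuous_fderiv one_ne_zero)).pow 2) ?_ _) ?_
  · filter_upwards [hH0] with x hx
    simp [Function.comp, hx, ctrace_zero]
  · refine ((hasCompactSupport_gradient hu.2.1).fderiv ℝ).mono fun x hx => ?_
    contrapose! hx
    simp only [Function.mem_support, not_not] at hx ⊢
    simp [hx, ctrace_zero]

theorem radial_energy_le_gradientEnergy {u : EuclideanSpace ℝ (Fin n) → ℝ}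
    (hu : u ∈ TestFunctions n) :
    ∫ x, ‖x‖ ^ (-(n : ℝ)) * ⟪x, gradient u x⟫_ℝ ^ 2 ≤ gradientEnergy (4 - (n : ℝ)) u := by
  obtain ⟨h1, h2, h3, h4⟩ := hu
  have hg := contDiff_gradient h1
  have hgc := hasCompactSupport_gradient h2
  have hg0 := gradient_eventuallyEq_zero h3
  refine integral_mono ?_ (integrable_gradient_density _ ⟨h1, h2, h3, h4⟩) fun x => ?_
  · refine Continuous.integrable_of_hasCompactSupport
      (continuous_norm_rpow_mul ((continuous_id.inner hg.continuous).pow 2) ?_ _) ?_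
    · filter_upwards [hg0] with y hy; simp [-inner_gradient_right, hy]
    · exact hgc.mono fun y hy => by contrapose! hy; simp_all [-inner_gradient_right]
  · by_cases hx : x = 0
    · simp [hx, hg0.self_of_nhds]
    · simp only []
      rw [norm_rpow_two_sub hx, mul_assoc, ← mul_pow ‖x‖, ← sq_abs ⟪x, gradient u x⟫_ℝ]
      gcongr
      exact abs_real_inner_le_norm _ _

theorem radial_energy_eq_gradientEnergy {u : EuclideanSpace ℝ (Fin n) → ℝ}
    (hu : u ∈ TestFunctions n) (hrad : IsRadial u) :
    ∫ x, ‖x‖ ^ (-(n : ℝ)) * ⟪x, gradient u x⟫_ℝ ^ 2 = gradientEnergy (4 - (n : ℝ)) u := by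
  have hg0 := gradient_eventuallyEq_zero hu.2.2.1
  refine integral_congr_ae (Eventually.of_forall fun x => ?_)
  by_cases hx : x = 0
  · simp [hx, hg0.self_of_nhds]
  · simp only []
    rw [norm_rpow_two_sub hx, mul_assoc,
      norm_sq_mul_norm_gradient_sq (hu.1.differentiable two_ne_zero) hrad]

theorem min_le_quotient (hn : 2 ≤ n) {u : EuclideanSpace ℝ (Fin n) → ℝ}
    (hu : u ∈ TestFunctions n) :
    min (((n : ℝ) - 2) ^ 2) ((n : ℝ) - 1) ≤ quotient (4 - (n : ℝ)) u := by
  -- In dimension two the minimum is 0; the field inequality is unavailable there, its coefficients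
  -- having the denominator n - 2.
  rcases hn.eq_or_lt with rfl | hn
  · exact le_trans (by norm_num) (quotient_nonneg _ u)
  rw [quotient, le_div_iff₀ (gradientEnergy_pos _ hu)]
  refine le_trans ?_ (radial_add_angular_energy_le hn hu)
  have hA : 0 ≤ ∫ x, ‖x‖ ^ (-(n : ℝ)) * ⟪x, gradient u x⟫_ℝ ^ 2 :=
    integral_nonneg fun x => by positivity
  have hB := sub_nonneg.2 (radial_energy_le_gradientEnergy hu)
  have h1 := mul_le_mul_of_nonneg_right (min_le_left (((n : ℝ) - 2) ^ 2) ((n : ℝ) - 1)) hA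
  have h2 := mul_le_mul_of_nonneg_right (min_le_right (((n : ℝ) - 2) ^ 2) ((n : ℝ) - 1)) hB
  linarith

theorem sq_le_quotient_of_isRadial (hn : 3 ≤ n) {u : EuclideanSpace ℝ (Fin n) → ℝ}
    (hu : u ∈ TestFunctions n) (hrad : IsRadial u) :
    ((n : ℝ) - 2) ^ 2 ≤ quotient (4 - (n : ℝ)) u := by
  rw [quotient, le_div_iff₀ (gradientEnergy_pos _ hu)]
  have h := radial_add_angular_energy_le hn hu
  rw [radial_energy_eq_gradientEnergy hu hrad] at h
  linarith

theorem bddBelow_quotient (α : ℝ) (s : Set (EuclideanSpace ℝ (Fin n) → ℝ)) :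
    BddBelow (quotient α '' s) := by
  refine ⟨0, ?_⟩
  rintro _ ⟨u, -, rfl⟩
  exact quotient_nonneg α u

theorem min_le_bestConstant (hn : 2 ≤ n) :
    min (((n : ℝ) - 2) ^ 2) ((n : ℝ) - 1) ≤ bestConstant n (4 - (n : ℝ)) := by
  obtain ⟨u, hu⟩ := exists_radial_testFunction (n := n) (by omega)
  refine le_csInf ⟨_, u, hu.1, rfl⟩ ?_
  rintro _ ⟨v, hv, rfl⟩
  exact min_le_quotient hn hv

theorem sq_le_radialConstant (hn : 3 ≤ n) :
    ((n : ℝ) - 2) ^ 2 ≤ radialConstant n (4 - (n : ℝ)) := by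
  obtain ⟨u, hu⟩ := exists_radial_testFunction (n := n) (by omega)
  refine le_csInf ⟨_, u, hu, rfl⟩ ?_
  rintro _ ⟨v, hv, rfl⟩
  exact sq_le_quotient_of_isRadial hn hv.1 hv.2

end LowerBound
-- Functions χ(log|x|)(c + ⟨e, x⟩) and logarithmic polar coordinates
section LogProfile

variable {V : Type*} [NormedAddCommGroup V] [InnerProductSpace ℝ V] [FiniteDimensional ℝ V]

theorem hasFDerivAt_comp_log_norm {f : ℝ → ℝ} {f' : ℝ} {x : V} (hx : x ≠ 0)
    (hf : HasDerivAt f f' (Real.log ‖x‖)) :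
    HasFDerivAt (fun y : V => f (Real.log ‖y‖)) ((f' * (‖x‖ ^ 2)⁻¹) • innerSL ℝ x) x := by
  have hx' : 0 < ‖x‖ := norm_pos_iff.2 hx
  have h1 : HasFDerivAt (fun y : V => ‖y‖ ^ 2) (2 • innerSL ℝ x) x :=
    (hasStrictFDerivAt_norm_sq x).hasFDerivAt
  have h2 := (h1.log (by positivity)).const_mul (1 / 2)
  have h3 : (fun y : V => (1 / 2 : ℝ) * Real.log (‖y‖ ^ 2)) = fun y => Real.log ‖y‖ := by
    ext y
    rw [Real.log_pow]
    push_cast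
    ring
  rw [h3] at h2
  refine (hf.comp_hasFDerivAt x h2).congr_fderiv ?_
  ext v
  simp
  ring

theorem exp_neg_two_mul_log_norm {x : V} (hx : x ≠ 0) :
    Real.exp (-2 * Real.log ‖x‖) = (‖x‖ ^ 2)⁻¹ := by
  have hx' : 0 < ‖x‖ := norm_pos_iff.2 hx
  rw [neg_mul, Real.exp_neg, ← Real.log_rpow hx', Real.exp_log (by positivity)]
  norm_cast

/-- The gradient of `χ(log ‖x‖) (c + ⟪e, x⟫)`. -/
theorem hasGradientAt_log_profile {χ : ℝ → ℝ} {χ₁ : ℝ} {x : V} (hx : x ≠ 0)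
    (h1 : HasDerivAt χ χ₁ (Real.log ‖x‖)) (c : ℝ) (e : V) :
    HasGradientAt (fun y : V => χ (Real.log ‖y‖) * (c + ⟪e, y⟫_ℝ))
      ((χ₁ * (‖x‖ ^ 2)⁻¹ * (c + ⟪e, x⟫_ℝ)) • x + χ (Real.log ‖x‖) • e) x := by
  rw [hasGradientAt_iff_hasFDerivAt]
  have hl : HasFDerivAt (fun y : V => c + ⟪e, y⟫_ℝ) (innerSL ℝ e) x :=
    (innerSL ℝ e).hasFDerivAt.const_add c
  refine ((hasFDerivAt_comp_log_norm hx h1).mul hl).congr_fderiv ?_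
  ext v
  simp
  ring

theorem ctrace_fderiv_gradient_log_profile {χ χ₁ χ₂ : ℝ → ℝ}
    (h1 : ∀ t, HasDerivAt χ (χ₁ t) t) (h2 : ∀ t, HasDerivAt χ₁ (χ₂ t) t) (c : ℝ) (e : V)
    {x : V} (hx : x ≠ 0) :
    ctrace (fderiv ℝ (gradient fun y : V => χ (Real.log ‖y‖) * (c + ⟪e, y⟫_ℝ)) x) =
      (‖x‖ ^ 2)⁻¹ * ((χ₂ (Real.log ‖x‖) + ((Module.finrank ℝ V : ℝ) - 2) * χ₁ (Real.log ‖x‖)) *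
        (c + ⟪e, x⟫_ℝ) + 2 * χ₁ (Real.log ‖x‖) * ⟪e, x⟫_ℝ) := by
  have hx2 : ‖x‖ ^ 2 ≠ 0 := by have := norm_pos_iff.2 hx; positivity
  -- Absorbing ‖x‖⁻² makes the coefficient of the gradient again a function of log ‖x‖, so the same
  -- chain rule differentiates it.
  let κ : ℝ → ℝ := fun t => χ₁ t * Real.exp (-2 * t)
  have hκ : ∀ t, HasDerivAt κ ((χ₂ t - 2 * χ₁ t) * Real.exp (-2 * t)) t := by
    intro t
    have := (h2 t).mul (((hasDerivAt_id t).const_mul (-2)).exp)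
    refine this.congr_deriv ?_
    simp only [id]
    ring
  have hG : (gradient fun y : V => χ (Real.log ‖y‖) * (c + ⟪e, y⟫_ℝ)) =ᶠ[𝓝 x]
      fun y => (κ (Real.log ‖y‖) * (c + ⟪e, y⟫_ℝ)) • y + χ (Real.log ‖y‖) • e := by
    filter_upwards [isOpen_ne.mem_nhds hx] with y hy
    rw [(hasGradientAt_log_profile hy (h1 _) c e).gradient]
    simp only [κ, exp_neg_two_mul_log_norm hy]
  have hl : HasFDerivAt (fun y : V => c + ⟪e, y⟫_ℝ) (innerSL ℝ e) x :=
    (innerSL ℝ e).hasFDerivAt.const_add c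
  have hd := (((hasFDerivAt_comp_log_norm hx (hκ _)).mul hl).smul (hasFDerivAt_id x)).add
    ((hasFDerivAt_comp_log_norm hx (h1 _)).smul_const e)
  refine (congrArg ctrace (hG.fderiv_eq.trans hd.fderiv)).trans ?_
  rw [ctrace_add, ctrace_add, ctrace_smul, ctrace_smulRight,
    ctrace_smulRight, ctrace_id]
  simp only [κ, exp_neg_two_mul_log_norm hx, id, Pi.mul_apply, add_apply,
    smul_apply, innerSL_apply_apply, smul_eq_mul, real_inner_self_eq_norm_sq,
    real_inner_comm x e]
  field_simp
  ring

theorem norm_gradient_sq_log_profile {χ χ₁ : ℝ → ℝ} (h1 : ∀ t, HasDerivAt χ (χ₁ t) t) (c : ℝ)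
    (e : V) {x : V} (hx : x ≠ 0) :
    ‖gradient (fun y : V => χ (Real.log ‖y‖) * (c + ⟪e, y⟫_ℝ)) x‖ ^ 2 =
      (‖x‖ ^ 2)⁻¹ * (χ₁ (Real.log ‖x‖) ^ 2 * (c + ⟪e, x⟫_ℝ) ^ 2 +
        2 * χ (Real.log ‖x‖) * χ₁ (Real.log ‖x‖) * (c + ⟪e, x⟫_ℝ) * ⟪e, x⟫_ℝ +
        ‖x‖ ^ 2 * χ (Real.log ‖x‖) ^ 2 * ‖e‖ ^ 2) := by
  have hx2 : ‖x‖ ≠ 0 := norm_ne_zero_iff.2 hx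
  rw [(hasGradientAt_log_profile hx (h1 _) c e).gradient, norm_add_sq_real, norm_smul, norm_smul,
    mul_pow, mul_pow, Real.norm_eq_abs, Real.norm_eq_abs, sq_abs, sq_abs, inner_smul_left,
    inner_smul_right, real_inner_comm x e]
  simp only [RCLike.conj_to_real]
  field_simp

variable [MeasurableSpace V] [BorelSpace V]

theorem integral_comp_log_mul_inv (f : ℝ → ℝ) :
    ∫ y in Set.Ioi (0 : ℝ), y⁻¹ * f (Real.log y) = ∫ t, f t := by
  have h := integral_image_eq_integral_abs_deriv_smul (s := Set.univ) MeasurableSet.univ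
    (fun x _ => (Real.hasDerivAt_exp x).hasDerivWithinAt) Real.exp_injective.injOn
    (fun y => y⁻¹ * f (Real.log y))
  rw [Set.image_univ, Real.range_exp] at h
  rw [h, setIntegral_univ]
  refine integral_congr_ae (Eventually.of_forall fun t => ?_)
  simp [abs_of_pos (Real.exp_pos t)]

/-- Integration in logarithmic polar coordinates. -/
theorem integral_norm_rpow_mul_comp_log [Nontrivial V] (f : ℝ → ℝ) :
    ∫ x : V, ‖x‖ ^ (-(Module.finrank ℝ V : ℝ)) * f (Real.log ‖x‖) =
      (Module.finrank ℝ V * (volume : Measure V).real (Metric.ball 0 1)) * ∫ t, f t := by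
  have hd : 0 < Module.finrank ℝ V := Module.finrank_pos
  rw [integral_fun_norm_addHaar volume
    (fun r : ℝ => r ^ (-(Module.finrank ℝ V : ℝ)) * f (Real.log r)), ← integral_comp_log_mul_inv f,
    nsmul_eq_mul, smul_eq_mul, mul_assoc]
  congr 2
  refine setIntegral_congr_fun measurableSet_Ioi fun r (hr : 0 < r) => ?_
  simp only [smul_eq_mul]
  rw [← mul_assoc, ← Real.rpow_natCast, ← Real.rpow_add hr, Nat.cast_sub hd, ← Real.rpow_neg_one]
  congr 2
  push_cast
  ring

theorem finrank_mul_volume_ball_pos [Nontrivial V] :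
    0 < Module.finrank ℝ V * (volume : Measure V).real (Metric.ball 0 1) :=
  mul_pos (by exact_mod_cast Module.finrank_pos) 
    (ENNReal.toReal_pos (Metric.measure_ball_pos volume 0 one_pos).ne' measure_ball_lt_top.ne)

end LogProfile

/-! ### Passage to the limit in the scaling parameter -/

section Bump

/-- All integrands live on the fixed compact set K, so the integral is continuous in ε. This is the
limit of the rescaled numerators of both test families. -/
theorem tendsto_integral_sq_quadratic {a b d : ℝ → ℝ} (ha : Continuous a) (hb : Continuous b)
    (hd : Continuous d) {K : Set ℝ} (hK : IsCompact K) (ha0 : ∀ t ∉ K, a t = 0)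
    (hb0 : ∀ t ∉ K, b t = 0) (hd0 : ∀ t ∉ K, d t = 0) :
    Tendsto (fun ε : ℝ => ∫ t, (ε ^ 2 * a t + ε * b t + d t) ^ 2) (𝓝[>] 0) (𝓝 (∫ t, d t ^ 2)) := by
  have h : ContinuousOn (fun ε : ℝ => ∫ t, (ε ^ 2 * a t + ε * b t + d t) ^ 2) Set.univ := by
    refine continuousOn_integral_of_compact_support hK ?_ ?_
    · apply Continuous.continuousOn
      simp only [Function.uncurry_def]
      fun_prop
    · intro ε t _ ht
      simp [ha0 t ht, hb0 t ht, hd0 t ht]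
  have h2 := (continuousOn_univ.1 h).tendsto 0
  simpa using h2.mono_left nhdsWithin_le_nhds

end Bump
-- One-dimensional inequalities from the two test families
section TestFamilies

/-- A nonzero `C²` function on the line with compact support in `(0, ∞)`, with its first two
derivatives. -/
structure IsLogProfile (χ χ₁ χ₂ : ℝ → ℝ) : Prop where
  contDiff : ContDiff ℝ 2 χ
  deriv_one : ∀ t, HasDerivAt χ (χ₁ t) t
  deriv_two : ∀ t, HasDerivAt χ₁ (χ₂ t) t
  zero_of_neg : ∀ t ≤ 0, χ t = 0
  zero_of_large : ∃ T, ∀ t, T < t → χ t = 0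
  exists_ne : ∃ t, χ t ≠ 0

variable {n : ℕ} {χ χ₁ χ₂ : ℝ → ℝ}

/-- As χ vanishes on (-∞, 0], the function vanishes on the unit ball. The vector v gives a ray on
which the affine factor has no zero, so the product is nonzero wherever χ is. -/
theorem IsLogProfile.mem_testFunctions (h : IsLogProfile χ χ₁ χ₂) (c : ℝ)
    (e : EuclideanSpace ℝ (Fin n))
    (hne : ∃ v : EuclideanSpace ℝ (Fin n), ‖v‖ = 1 ∧ ∀ r > 0, c + r * ⟪e, v⟫_ℝ ≠ 0) :
    (fun x => χ (Real.log ‖x‖) * (c + ⟪e, x⟫_ℝ)) ∈ TestFunctions n := by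
  have h0 : (fun x : EuclideanSpace ℝ (Fin n) => χ (Real.log ‖x‖) * (c + ⟪e, x⟫_ℝ)) =ᶠ[𝓝 0] 0 := by
    filter_upwards [Metric.ball_mem_nhds (0 : EuclideanSpace ℝ (Fin n)) one_pos] with x hx
    have hx' : ‖x‖ < 1 := by simpa using hx
    simp [h.zero_of_neg _ (Real.log_nonpos (norm_nonneg x) hx'.le)]
  refine ⟨?_, ?_, notMem_tsupport_iff_eventuallyEq.2 h0, ?_⟩
  · refine contDiff_of_contDiffAt_of_eventuallyEq_zero h0 fun x hx => ?_
    exact (h.contDiff.contDiffAt.comp x ((contDiffAt_norm ℝ hx).log (norm_ne_zero_iff.2 hx))).mul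
      (contDiffAt_const.add (contDiffAt_const.inner ℝ contDiffAt_id))
  · obtain ⟨T, hT⟩ := h.zero_of_large
    refine HasCompactSupport.intro
      (isCompact_closedBall (0 : EuclideanSpace ℝ (Fin n)) (Real.exp T)) fun x hx => ?_
    have hx' : Real.exp T < ‖x‖ := by simpa using hx
    have := (Real.lt_log_iff_exp_lt ((Real.exp_pos T).trans hx')).2 hx'
    simp [hT _ this]
  · obtain ⟨t, ht⟩ := h.exists_ne
    obtain ⟨v, hv1, hv⟩ := hne
    intro hu
    have h1 := congrFun hu (Real.exp t • v)
    rw [norm_smul, hv1, mul_one, Real.norm_eq_abs, Real.log_abs, Real.log_exp,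
      inner_smul_right] at h1
    exact (mul_ne_zero ht (hv _ (Real.exp_pos t))) h1

/-- Without the quotient, the inequality can be summed over several test functions. -/
theorem bestConstant_mul_gradientEnergy_le {α : ℝ} {u : EuclideanSpace ℝ (Fin n) → ℝ}
    (hu : u ∈ TestFunctions n) : bestConstant n α * gradientEnergy α u ≤ laplacianEnergy α u := by
  rw [← le_div_iff₀ (gradientEnergy_pos α hu)]
  exact csInf_le (bddBelow_quotient α _) ⟨u, hu, rfl⟩

theorem ae_ne_zero (hn : 2 ≤ n) : ∀ᵐ x : EuclideanSpace ℝ (Fin n), x ≠ 0 := by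
  have : Nontrivial (EuclideanSpace ℝ (Fin n)) :=
    Module.nontrivial_of_finrank_pos (R := ℝ) (by simp; omega)
  simp [ae_iff, measure_singleton]

theorem norm_rpow_four_sub {x : EuclideanSpace ℝ (Fin n)} (hx : x ≠ 0) (c : ℝ) :
    ‖x‖ ^ (4 - c) = ‖x‖ ^ (-c) * (‖x‖ ^ 2) ^ 2 := by
  rw [sub_eq_add_neg, add_comm, Real.rpow_add (norm_pos_iff.2 hx), ← pow_mul]
  norm_cast

/-- C is the area of the unit sphere; only its sign matters, since it cancels. -/
theorem exists_pos_integral_norm_rpow (hn : 2 ≤ n) : ∃ C : ℝ, 0 < C ∧ ∀ f : ℝ → ℝ,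
    ∫ x : EuclideanSpace ℝ (Fin n), ‖x‖ ^ (-(n : ℝ)) * f (Real.log ‖x‖) = C * ∫ t, f t := by
  have : Nontrivial (EuclideanSpace ℝ (Fin n)) :=
    Module.nontrivial_of_finrank_pos (R := ℝ) (by simp; omega)
  refine ⟨_, finrank_mul_volume_ball_pos (V := EuclideanSpace ℝ (Fin n)), fun f => ?_⟩
  rw [← integral_norm_rpow_mul_comp_log]
  simp

theorem IsLogProfile.bestConstant_mul_le_radial (hn : 2 ≤ n) (h : IsLogProfile χ χ₁ χ₂) :
    bestConstant n (4 - (n : ℝ)) * ∫ t, χ₁ t ^ 2 ≤ ∫ t, (χ₂ t + ((n : ℝ) - 2) * χ₁ t) ^ 2 := by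
  obtain ⟨C, hC, hpolar⟩ := exists_pos_integral_norm_rpow hn
  have hu := h.mem_testFunctions (n := n) 1 0
    ⟨EuclideanSpace.single ⟨0, by omega⟩ 1, by simp, by simp⟩
  have hle := bestConstant_mul_gradientEnergy_le (α := 4 - (n : ℝ)) hu
  have hD : gradientEnergy (4 - (n : ℝ)) (fun x : EuclideanSpace ℝ (Fin n) =>
      χ (Real.log ‖x‖) * (1 + ⟪0, x⟫_ℝ)) = C * ∫ t, χ₁ t ^ 2 := by
    rw [← hpolar]
    refine integral_congr_ae ?_
    filter_upwards [ae_ne_zero hn] with x hx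
    have hx2 : ‖x‖ ≠ 0 := norm_ne_zero_iff.2 hx
    rw [norm_gradient_sq_log_profile h.deriv_one _ _ hx, norm_rpow_two_sub hx]
    simp only [inner_zero_left, norm_zero]
    field_simp
    ring
  have hN : laplacianEnergy (4 - (n : ℝ)) (fun x : EuclideanSpace ℝ (Fin n) =>
      χ (Real.log ‖x‖) * (1 + ⟪0, x⟫_ℝ)) =
      C * ∫ t, (χ₂ t + ((n : ℝ) - 2) * χ₁ t) ^ 2 := by
    rw [← hpolar]
    refine integral_congr_ae ?_
    filter_upwards [ae_ne_zero hn] with x hx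
    have hx2 : ‖x‖ ≠ 0 := norm_ne_zero_iff.2 hx
    rw [laplacian_eq_ctrace hu.1, ctrace_fderiv_gradient_log_profile h.deriv_one h.deriv_two _ _ hx,
      norm_rpow_four_sub hx]
    simp only [inner_zero_left, finrank_euclideanSpace, Fintype.card_fin]
    field_simp
    ring
  rw [hD, hN, mul_left_comm] at hle
  exact le_of_mul_le_mul_left hle hC

/-- The test functions χ(log|x|)⟨bᵢ, x⟩ are summed over an orthonormal basis: ∑⟨bᵢ, x⟩² = |x|² makes
the total densities radial, and no spherical integral is needed. The factor e^(2t) is this |x|². -/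
theorem IsLogProfile.bestConstant_mul_le_linear (hn : 2 ≤ n) (h : IsLogProfile χ χ₁ χ₂) :
    bestConstant n (4 - (n : ℝ)) *
      ∫ t, Real.exp (2 * t) * (χ₁ t ^ 2 + 2 * χ t * χ₁ t + (n : ℝ) * χ t ^ 2) ≤
    ∫ t, Real.exp (2 * t) * (χ₂ t + (n : ℝ) * χ₁ t) ^ 2 := by
  obtain ⟨C, hC, hpolar⟩ := exists_pos_integral_norm_rpow hn
  let b := EuclideanSpace.basisFun (Fin n) ℝ
  let u : Fin n → EuclideanSpace ℝ (Fin n) → ℝ := fun i x => χ (Real.log ‖x‖) * (0 + ⟪b i, x⟫_ℝ)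
  have hb : ∀ i, ‖b i‖ = 1 := b.norm_eq_one
  have hsum : ∀ x, ∑ i, ⟪b i, x⟫_ℝ ^ 2 = ‖x‖ ^ 2 := fun x => by
    rw [← b.sum_sq_norm_inner_right x]
    simp only [Real.norm_eq_abs, sq_abs]
  have hu : ∀ i, u i ∈ TestFunctions n := fun i => h.mem_testFunctions 0 (b i)
    ⟨b i, hb i, fun r hr => by rw [real_inner_self_eq_norm_sq, hb]; simpa using hr.ne'⟩
  have hexp : ∀ x : EuclideanSpace ℝ (Fin n), x ≠ 0 →
      Real.exp (2 * Real.log ‖x‖) = ‖x‖ ^ 2 := fun x hx => by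
    have hx' : 0 < ‖x‖ := norm_pos_iff.2 hx
    rw [← Real.log_rpow hx', Real.exp_log (by positivity)]
    norm_cast
  have hle : ∑ i, bestConstant n (4 - (n : ℝ)) * gradientEnergy (4 - (n : ℝ)) (u i) ≤
      ∑ i, laplacianEnergy (4 - (n : ℝ)) (u i) :=
    Finset.sum_le_sum fun i _ => bestConstant_mul_gradientEnergy_le (hu i)
  have hD : ∑ i, gradientEnergy (4 - (n : ℝ)) (u i) =
      C * ∫ t, Real.exp (2 * t) * (χ₁ t ^ 2 + 2 * χ t * χ₁ t + (n : ℝ) * χ t ^ 2) := by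
    rw [← hpolar]
    unfold gradientEnergy
    rw [← integral_finsetSum _ fun i _ => integrable_gradient_density _ (hu i)]
    refine integral_congr_ae ?_
    filter_upwards [ae_ne_zero hn] with x hx
    have hx2 : ‖x‖ ≠ 0 := norm_ne_zero_iff.2 hx
    have : ∀ i, ‖x‖ ^ (4 - (n : ℝ) - 2) * ‖gradient (u i) x‖ ^ 2 = ‖x‖ ^ (-(n : ℝ)) *
        ((χ₁ (Real.log ‖x‖) ^ 2 + 2 * χ (Real.log ‖x‖) * χ₁ (Real.log ‖x‖)) * ⟪b i, x⟫_ℝ ^ 2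
          + ‖x‖ ^ 2 * χ (Real.log ‖x‖) ^ 2) := by
      intro i
      rw [norm_gradient_sq_log_profile h.deriv_one _ _ hx, norm_rpow_two_sub hx, hb]
      field_simp
      ring
    simp only [this]
    rw [← Finset.mul_sum, Finset.sum_add_distrib, ← Finset.mul_sum, hsum, hexp x hx]
    simp only [Finset.sum_const, Finset.card_univ, Fintype.card_fin, nsmul_eq_mul]
    ring
  have hN : ∑ i, laplacianEnergy (4 - (n : ℝ)) (u i) =
      C * ∫ t, Real.exp (2 * t) * (χ₂ t + (n : ℝ) * χ₁ t) ^ 2 := by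
    rw [← hpolar]
    unfold laplacianEnergy
    rw [← integral_finsetSum _ fun i _ => integrable_laplacian_density _ (hu i)]
    refine integral_congr_ae ?_
    filter_upwards [ae_ne_zero hn] with x hx
    have hx2 : ‖x‖ ≠ 0 := norm_ne_zero_iff.2 hx
    have : ∀ i, ‖x‖ ^ (4 - (n : ℝ)) * Laplacian.laplacian (u i) x ^ 2 = ‖x‖ ^ (-(n : ℝ)) *
        (χ₂ (Real.log ‖x‖) + (n : ℝ) * χ₁ (Real.log ‖x‖)) ^ 2 * ⟪b i, x⟫_ℝ ^ 2 := by
      intro i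
      rw [laplacian_eq_ctrace (hu i).1,
        ctrace_fderiv_gradient_log_profile h.deriv_one h.deriv_two _ _ hx, norm_rpow_four_sub hx]
      simp only [finrank_euclideanSpace, Fintype.card_fin]
      field_simp
      ring
    simp only [this]
    rw [← Finset.mul_sum, hsum, hexp x hx]
    ring
  rw [← Finset.mul_sum, hD, hN, mul_left_comm] at hle
  exact le_of_mul_le_mul_left hle hC

end TestFamilies

/-! ### Upper bounds by slowly varying cutoffs -/

section UpperBound

theorem deriv_eq_zero_of_notMem_Icc {φ : ℝ → ℝ} {a b : ℝ} (h : ∀ t ∉ Set.Icc a b, φ t = 0) :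
    ∀ t ∉ Set.Icc a b, deriv φ t = 0 := by
  intro t ht
  have : φ =ᶠ[𝓝 t] fun _ => 0 := by
    filter_upwards [isClosed_Icc.isOpen_compl.mem_nhds ht] with s hs using h s hs
  rw [this.deriv_eq, deriv_const]

theorem isLogProfile_comp_mul {φ φ₁ φ₂ : ℝ → ℝ} (hφ : ContDiff ℝ 2 φ)
    (h1 : ∀ t, HasDerivAt φ (φ₁ t) t) (h2 : ∀ t, HasDerivAt φ₁ (φ₂ t) t)
    (h0 : ∀ t ∉ Set.Icc (1 : ℝ) 3, φ t = 0) (hne : ∃ t, φ t ≠ 0) {ε : ℝ} (hε : 0 < ε) :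
    IsLogProfile (fun t => φ (ε * t)) (fun t => ε * φ₁ (ε * t)) (fun t => ε ^ 2 * φ₂ (ε * t)) := by
  have hm : ∀ t, HasDerivAt (fun t => ε * t) ε t := fun t => by
    simpa using (hasDerivAt_id t).const_mul ε
  refine ⟨hφ.comp (contDiff_const.mul contDiff_id), fun t => ?_, fun t => ?_, fun t ht => ?_,
    ⟨3 / ε, fun t ht => ?_⟩, ?_⟩
  · exact ((h1 _).comp t (hm t)).congr_deriv (mul_comm _ _)
  · exact (((h2 _).comp t (hm t)).const_mul ε).congr_deriv (by ring)
  · refine h0 _ fun hmem => ?_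
    have := mul_nonpos_of_nonneg_of_nonpos hε.le ht
    linarith [hmem.1]
  · refine h0 _ fun hmem => ?_
    have := (div_lt_iff₀' hε).1 ht
    linarith [hmem.2]
  · obtain ⟨t, ht⟩ := hne
    exact ⟨t / ε, by rwa [mul_div_cancel₀ _ hε.ne']⟩

/-- The factor e^(-t) = 1/|x| turns ⟨b, x⟩ into a function homogeneous of degree zero and cancels
the weight e^(2t). -/
theorem IsLogProfile.exp_neg_mul {χ χ₁ χ₂ : ℝ → ℝ} (h : IsLogProfile χ χ₁ χ₂) :
    IsLogProfile (fun t => Real.exp (-t) * χ t) (fun t => Real.exp (-t) * (χ₁ t - χ t))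
      (fun t => Real.exp (-t) * (χ₂ t - 2 * χ₁ t + χ t)) := by
  have hm : ∀ t, HasDerivAt (fun t => Real.exp (-t)) (-Real.exp (-t)) t := fun t => by
    simpa using (hasDerivAt_neg t).exp
  refine ⟨contDiff_neg.exp.mul h.contDiff, fun t => ?_, fun t => ?_, fun t ht => ?_, ?_, ?_⟩
  · exact ((hm t).mul (h.deriv_one t)).congr_deriv (by ring)
  · exact ((hm t).mul ((h.deriv_two t).sub (h.deriv_one t))).congr_deriv
      (by simp only [Pi.sub_apply]; ring)
  · simp [h.zero_of_neg t ht]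
  · obtain ⟨T, hT⟩ := h.zero_of_large
    exact ⟨T, fun t ht => by simp [hT t ht]⟩
  · obtain ⟨t, ht⟩ := h.exists_ne
    exact ⟨t, mul_ne_zero (Real.exp_ne_zero _) ht⟩

theorem exists_bump : ∃ φ φ₁ φ₂ : ℝ → ℝ, ContDiff ℝ 2 φ ∧ Continuous φ₁ ∧ Continuous φ₂ ∧
    (∀ t, HasDerivAt φ (φ₁ t) t) ∧ (∀ t, HasDerivAt φ₁ (φ₂ t) t) ∧
    (∀ t ∉ Set.Icc (1 : ℝ) 3, φ t = 0) ∧ (∀ t ∉ Set.Icc (1 : ℝ) 3, φ₁ t = 0) ∧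
    (∀ t ∉ Set.Icc (1 : ℝ) 3, φ₂ t = 0) ∧ φ 2 ≠ 0 := by
  let f : ContDiffBump (2 : ℝ) := ⟨1 / 2, 1, by norm_num, by norm_num⟩
  have hf : ContDiff ℝ 2 f := f.contDiff
  have hf1 : ContDiff ℝ 1 (deriv f) := by
    have : ContDiff ℝ (1 + 1) f := by norm_num; exact hf
    exact (contDiff_succ_iff_deriv.1 this).2.2
  have h0 : ∀ t ∉ Set.Icc (1 : ℝ) 3, f t = 0 := fun t ht => f.zero_of_le_dist ?_
  · refine ⟨f, deriv f, deriv (deriv f), hf, hf1.continuous, hf1.continuous_deriv le_rfl,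
      fun t => (hf.differentiable two_ne_zero t).hasDerivAt,
      fun t => (hf1.differentiable one_ne_zero t).hasDerivAt, h0,
      deriv_eq_zero_of_notMem_Icc h0,
      deriv_eq_zero_of_notMem_Icc (deriv_eq_zero_of_notMem_Icc h0), ?_⟩
    rw [f.one_of_mem_closedBall (by simp [f])]
    exact one_ne_zero
  rw [Set.mem_Icc, not_and_or, not_le, not_le] at ht
  rw [Real.dist_eq]
  change 1 ≤ |t - 2|
  rcases ht with ht | ht
  · exact le_trans (by linarith) (neg_le_abs _)
  · exact le_trans (by linarith) (le_abs_self _)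

theorem integral_sq_pos {f : ℝ → ℝ} (hf : Continuous f) {K : Set ℝ} (hK : IsCompact K)
    (h0 : ∀ t ∉ K, f t = 0) {t : ℝ} (ht : f t ≠ 0) : 0 < ∫ t, f t ^ 2 :=
  (hf.pow 2).integral_pos_of_hasCompactSupport_nonneg_nonzero
    (HasCompactSupport.intro hK fun s hs => by simp [h0 s hs]) (fun s => sq_nonneg _)
    (x := t) (by simpa using ht)

theorem integral_comp_mul_pos (g : ℝ → ℝ) {ε : ℝ} (hε : 0 < ε) :
    ∫ t, g (ε * t) = ε⁻¹ * ∫ t, g t := by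
  rw [Measure.integral_comp_mul_left, abs_of_pos (inv_pos.2 hε), smul_eq_mul]

variable {n : ℕ}

theorem bestConstant_le_sq (hn : 2 ≤ n) :
    bestConstant n (4 - (n : ℝ)) ≤ ((n : ℝ) - 2) ^ 2 := by
  obtain ⟨φ, φ₁, φ₂, hφ, hc1, hc2, h1, h2, z0, z1, z2, hne⟩ := exists_bump
  have hpos : 0 < ∫ t, φ₁ t ^ 2 := by
    have : ∃ t, φ₁ t ≠ 0 := by
      -- Otherwise φ would be constant, against φ(2) ≠ 0 = φ(4).
      by_contra! hcon
      have := is_const_of_deriv_eq_zero (hφ.differentiable two_ne_zero)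
        (fun t => (h1 t).deriv.trans (hcon t)) 2 4
      exact hne (this.trans (z0 4 (by norm_num)))
    obtain ⟨t, ht⟩ := this
    exact integral_sq_pos hc1 isCompact_Icc z1 ht
  have key : ∀ ε > 0, bestConstant n (4 - (n : ℝ)) * ∫ t, φ₁ t ^ 2 ≤
      ∫ t, (ε ^ 2 * 0 + ε * φ₂ t + ((n : ℝ) - 2) * φ₁ t) ^ 2 := by
    intro ε hε
    have h := (isLogProfile_comp_mul hφ h1 h2 z0 ⟨2, hne⟩ hε).bestConstant_mul_le_radial hn
    have e1 : ∫ t, (ε * φ₁ (ε * t)) ^ 2 = ε * ∫ t, φ₁ t ^ 2 := by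
      rw [integral_comp_mul_pos (fun t => (ε * φ₁ t) ^ 2) hε]
      simp only [mul_pow, integral_const_mul]
      field_simp
    have e2 : ∫ t, (ε ^ 2 * φ₂ (ε * t) + ((n : ℝ) - 2) * (ε * φ₁ (ε * t))) ^ 2 =
        ε * ∫ t, (ε ^ 2 * 0 + ε * φ₂ t + ((n : ℝ) - 2) * φ₁ t) ^ 2 := by
      rw [integral_comp_mul_pos (fun t => (ε ^ 2 * φ₂ t + ((n : ℝ) - 2) * (ε * φ₁ t)) ^ 2) hε,
        ← integral_const_mul, ← integral_const_mul]
      refine integral_congr_ae (Eventually.of_forall fun t => ?_)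
      simp only []
      field_simp
      ring
    rw [e1, e2, mul_left_comm] at h
    exact le_of_mul_le_mul_left h hε
  have hlim := tendsto_integral_sq_quadratic (a := fun _ => 0) (b := φ₂)
    (d := fun t => ((n : ℝ) - 2) * φ₁ t) continuous_const hc2 (continuous_const.mul hc1)
    (isCompact_Icc (a := (1 : ℝ)) (b := 3)) (fun _ _ => rfl) z2 (fun t ht => by simp [z1 t ht])
  have hle := ge_of_tendsto hlim (eventually_mem_nhdsWithin.mono fun ε hε => key ε hε)
  simp only [mul_pow, integral_const_mul] at hle
  exact le_of_mul_le_mul_right hle hpos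

theorem bestConstant_le_sub_one (hn : 2 ≤ n) :
    bestConstant n (4 - (n : ℝ)) ≤ (n : ℝ) - 1 := by
  obtain ⟨φ, φ₁, φ₂, hφ, hc1, hc2, h1, h2, z0, z1, z2, hne⟩ := exists_bump
  have hn1 : (0 : ℝ) < (n : ℝ) - 1 := by
    have : (2 : ℝ) ≤ n := by exact_mod_cast hn
    linarith
  have hpos : 0 < ∫ t, φ t ^ 2 := integral_sq_pos hφ.continuous isCompact_Icc z0 hne
  -- Needed to drop the term ε²φ₁² from the factor multiplying the constant.
  have hnonneg : 0 ≤ bestConstant n (4 - (n : ℝ)) :=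
    le_trans (le_min (sq_nonneg _) hn1.le) (min_le_bestConstant hn)
  have key : ∀ ε > 0, bestConstant n (4 - (n : ℝ)) * (((n : ℝ) - 1) * ∫ t, φ t ^ 2) ≤
      ∫ t, (ε ^ 2 * φ₂ t + ε * (((n : ℝ) - 2) * φ₁ t) + (-((n : ℝ) - 1)) * φ t) ^ 2 := by
    intro ε hε
    have h := (isLogProfile_comp_mul hφ h1 h2 z0 ⟨2, hne⟩ hε).exp_neg_mul.bestConstant_mul_le_linear
      hn
    have hexp : ∀ t : ℝ, Real.exp (2 * t) * Real.exp (-t) ^ 2 = 1 := fun t => by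
      rw [← Real.exp_nat_mul, ← Real.exp_add]
      norm_num
    have e1 : ∫ t, Real.exp (2 * t) * ((Real.exp (-t) * (ε * φ₁ (ε * t) - φ (ε * t))) ^ 2
          + 2 * (Real.exp (-t) * φ (ε * t)) * (Real.exp (-t) * (ε * φ₁ (ε * t) - φ (ε * t)))
          + (n : ℝ) * (Real.exp (-t) * φ (ε * t)) ^ 2) =
        ε⁻¹ * ∫ t, (ε ^ 2 * φ₁ t ^ 2 + ((n : ℝ) - 1) * φ t ^ 2) := by
      rw [← integral_comp_mul_pos (fun t => ε ^ 2 * φ₁ t ^ 2 + ((n : ℝ) - 1) * φ t ^ 2) hε]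
      refine integral_congr_ae (Eventually.of_forall fun t => ?_)
      linear_combination (ε ^ 2 * φ₁ (ε * t) ^ 2 + ((n : ℝ) - 1) * φ (ε * t) ^ 2) * hexp t
    have e2 : ∫ t, Real.exp (2 * t) * (Real.exp (-t) *
          (ε ^ 2 * φ₂ (ε * t) - 2 * (ε * φ₁ (ε * t)) + φ (ε * t))
          + (n : ℝ) * (Real.exp (-t) * (ε * φ₁ (ε * t) - φ (ε * t)))) ^ 2 =
        ε⁻¹ * ∫ t, (ε ^ 2 * φ₂ t + ε * (((n : ℝ) - 2) * φ₁ t) + (-((n : ℝ) - 1)) * φ t) ^ 2 := by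
      rw [← integral_comp_mul_pos (fun t =>
        (ε ^ 2 * φ₂ t + ε * (((n : ℝ) - 2) * φ₁ t) + (-((n : ℝ) - 1)) * φ t) ^ 2) hε]
      refine integral_congr_ae (Eventually.of_forall fun t => ?_)
      linear_combination (ε ^ 2 * φ₂ (ε * t) + ε * (((n : ℝ) - 2) * φ₁ (ε * t))
        + (-((n : ℝ) - 1)) * φ (ε * t)) ^ 2 * hexp t
    rw [e1, e2, mul_left_comm] at h
    refine le_trans (mul_le_mul_of_nonneg_left ?_ hnonneg)
      (le_of_mul_le_mul_left h (inv_pos.2 hε))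
    have i0 : Integrable fun t => ((n : ℝ) - 1) * φ t ^ 2 :=
      (((hφ.continuous.pow 2).integrable_of_hasCompactSupport (HasCompactSupport.intro
        (isCompact_Icc (a := (1 : ℝ)) (b := 3))
        fun s hs => by simp [z0 s hs])).const_mul _)
    have i1 : Integrable fun t => ε ^ 2 * φ₁ t ^ 2 :=
      (((hc1.pow 2).integrable_of_hasCompactSupport (HasCompactSupport.intro
        (isCompact_Icc (a := (1 : ℝ)) (b := 3))
        fun s hs => by simp [z1 s hs])).const_mul _)
    rw [← integral_const_mul]
    refine integral_mono i0 (i1.add i0) fun t => ?_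
    exact le_add_of_nonneg_left (by positivity)
  have hlim := tendsto_integral_sq_quadratic (a := φ₂) (b := fun t => ((n : ℝ) - 2) * φ₁ t)
    (d := fun t => (-((n : ℝ) - 1)) * φ t) hc2 (continuous_const.mul hc1)
    (continuous_const.mul hφ.continuous)
    (isCompact_Icc (a := (1 : ℝ)) (b := 3)) z2 (fun t ht => by simp [z1 t ht])
    (fun t ht => by simp [z0 t ht])
  -- In the limit, δ(n-1)∫φ² ≤ (n-1)²∫φ².
  have hle := ge_of_tendsto hlim (eventually_mem_nhdsWithin.mono fun ε hε => key ε hε)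
  simp only [mul_pow, integral_const_mul, neg_sq] at hle
  refine le_of_mul_le_mul_right ?_ (mul_pos hn1 hpos)
  linarith

theorem bestConstant_eq_min (hn : 2 ≤ n) :
    bestConstant n (4 - (n : ℝ)) = min (((n : ℝ) - 2) ^ 2) ((n : ℝ) - 1) :=
  le_antisymm (le_min (bestConstant_le_sq hn) (bestConstant_le_sub_one hn))
    (min_le_bestConstant hn)

end UpperBound
end WeightedRellich

theorem theorem4 (n : ℕ) (hn : 2 ≤ n) :
    WeightedRellich.bestConstant n (4 - (n : ℝ)) = min (((n : ℝ) - 2) ^ 2) ((n : ℝ) - 1) ∧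
    (3 ≤ n → 0 < WeightedRellich.bestConstant n (4 - (n : ℝ))) ∧
    (4 ≤ n →
      WeightedRellich.bestConstant n (4 - (n : ℝ)) = (n : ℝ) - 1 ∧
      (n : ℝ) - 1 < WeightedRellich.radialConstant n (4 - (n : ℝ))) := by
  refine ⟨WeightedRellich.bestConstant_eq_min hn, fun h3 => ?_, fun h4 => ?_⟩
  · have h3' : (3 : ℝ) ≤ n := by exact_mod_cast h3
    rw [WeightedRellich.bestConstant_eq_min hn]
    exact lt_min (pow_pos (by linarith) 2) (by linarith)
  · have h4' : (4 : ℝ) ≤ n := by exact_mod_cast h4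
    -- The difference n² - 5n + 5 is 1 at n = 4 but -1 at n = 3.
    have hlt : (n : ℝ) - 1 < ((n : ℝ) - 2) ^ 2 := by nlinarith
    refine ⟨?_, hlt.trans_le (WeightedRellich.sq_le_radialConstant (by omega))⟩
    rw [WeightedRellich.bestConstant_eq_min hn, min_eq_right hlt.le]
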